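/- Let $\widetilde M^{4n}$ be a para-quaternionic Kähler manifold: a smooth manifold with a pseudo-Riemannian metric $\widetilde g$ and a rank-3 bundle $Q\subset\operatorname{End}T\widetilde M$ of $\widetilde g$-skew-symmetric endomorphisms, preserved by the Levi-Civita connection $\widetilde\nabla$ of $\widetilde g$, which is locally generated by smooth anticommuting fields $J_1,J_2,J_3=J_1J_2$ with $J_\alpha^2=\epsilon_\alpha\mathrm{Id}$, where $(\epsilon_1,\epsilon_2,\epsilon_3)$ is a permutation of $(-1,1,1)$ (a *standard frame*). For a standard frame on an open set $\widetilde U\subset\widetilde M$ the connection forms $\omega_1,\omega_2,\omega_3$ are defined by $$\widetilde\nabla J_\alpha=-\epsilon_\beta\,\omega_\gamma\otimes J_\beta+\epsilon_\gamma\,\omega_\beta\otimes J_\gamma ,\qquad (\alpha,\beta,\gamma)\ \text{a cyclic permutation of}\ (1,2,3).$$ Let $\epsilon\in\{1,-1\}$, $m>1$, and let $(M^{2m},\mathcal J^\epsilon,g)$ be an almost $\epsilon$-Hermitian submanifold of $\widetilde M$: $M\subset\widetilde M$ is an (immersed) submanifold whose induced metric $g=\widetilde g|_M$ is nondegenerate,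 with a smooth section $J^\epsilon$ of $Q|_M$ such that $(J^\epsilon)^2=\epsilon\,\mathrm{Id}$ and $J^\epsilon TM=TM$, and $\mathcal J^\epsilon=J^\epsilon|_{TM}$. The structure $\mathcal J^\epsilon$ is *integrable* on an open subset of $M$ if its Nijenhuis tensor $$N(X,Y)=[\mathcal J^\epsilon X,\mathcal J^\epsilon Y]-\mathcal J^\epsilon[\mathcal J^\epsilon X,Y]-\mathcal J^\epsilon[X,\mathcal J^\epsilon Y]+\epsilon[X,Y]$$ vanishes there. An *adapted frame* along an open set $U\subset M$ is a standard frame $(J_1,J_2,J_3)$ with signs $(\epsilon,1,-\epsilon)$ on an open set $\widetilde U\subset\widetilde M$ containing $U$, such that $J_1=J^\epsilon$ along $U$; put $\psi=\omega_3\circ\mathcal J^\epsilon-\omega_2$, a 1-form on $U$. For $x\in M$ let $\overline{T_xM}$ be the maximal $Q_x$-invariant subspace of $T_xM$, and let $\mathcal D_x$ be a $\mathcal J^\epsilon$-invariant pure supplement: $T_xM=\overline{T_xM}\oplus\mathcal D_x$, and $\mathcal D_x$ contains no nonzero $Q_x$-invariant subspace. (The dimension of $\mathcal D_x$ does not depend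 on its choice.) Then: 1. $\mathcal J^\epsilon$ is integrable on $M$ if and only if $\psi=0$ for every adapted frame; and for each adapted frame along an open set $U\subset M$, $\mathcal J^\epsilon$ is integrable on $U$ if and only if $\psi=0$ on $U$. 2. $\mathcal J^\epsilon$ is integrable on $M$ if one of the following conditions holds: a) $\dim\mathcal D_x>2$ for all $x$ in some open dense subset of $M$; b) $M$ is connected, $(M,\mathcal J^\epsilon)$ is real analytic (that is, $M$ has an analytic atlas, compatible with its smooth structure, in which $\mathcal J^\epsilon$ is analytic), and $\dim\mathcal D_x>2$ at some point $x\in M$. -/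

import Mathlib

open Bundle Manifold Module
open scoped ContDiff Topology

noncomputable section

/-! ## Pseudo-Riemannian metrics and the Levi-Civita connection -/

section Ambient

variable (E : Type*) [NormedAddCommGroup E] [NormedSpace ℝ E]
  (N : Type*) [TopologicalSpace N] [ChartedSpace E N]

/-- A smooth pseudo-Riemannian metric: a smooth field of symmetric nondegenerate bilinear forms on
the tangent spaces (no sign is prescribed). -/
structure PseudoRiemannianMetric [IsManifold 𝓘(ℝ, E) ∞ N] where
  inner (x : N) : TangentSpace 𝓘(ℝ, E) x →L[ℝ] TangentSpace 𝓘(ℝ, E) x →L[ℝ] ℝ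
  symm (x : N) (v w : TangentSpace 𝓘(ℝ, E) x) : inner x v w = inner x w v
  nondegenerate (x : N) (v : TangentSpace 𝓘(ℝ, E) x) : (∀ w, inner x v w = 0) → v = 0
  contMDiff : ContMDiff 𝓘(ℝ, E) (𝓘(ℝ, E).prod 𝓘(ℝ, E →L[ℝ] E →L[ℝ] ℝ)) ∞
    (fun x => TotalSpace.mk' (E →L[ℝ] E →L[ℝ] ℝ)
      (E := fun x : N => TangentSpace 𝓘(ℝ, E) x →L[ℝ] TangentSpace 𝓘(ℝ, E) x →L[ℝ] ℝ)
      x (inner x))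

variable {E N}

/-- A vector field is differentiable at `x`. -/
def VectorFieldDiffAt [IsManifold 𝓘(ℝ, E) ∞ N] (Y : Π x : N, TangentSpace 𝓘(ℝ, E) x) (x : N) :
    Prop :=
  MDifferentiableAt 𝓘(ℝ, E) (𝓘(ℝ, E).prod 𝓘(ℝ, E))
    (fun y => TotalSpace.mk' E (E := (TangentSpace 𝓘(ℝ, E) : N → Type _)) y (Y y)) x

/-- A vector field is smooth on a set. -/
def VectorFieldSmoothOn [IsManifold 𝓘(ℝ, E) ∞ N] (Y : Π x : N, TangentSpace 𝓘(ℝ, E) x)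
    (V : Set N) : Prop :=
  ContMDiffOn 𝓘(ℝ, E) (𝓘(ℝ, E).prod 𝓘(ℝ, E)) ∞
    (fun y => TotalSpace.mk' E (E := (TangentSpace 𝓘(ℝ, E) : N → Type _)) y (Y y)) V

/-- A field of endomorphisms of the tangent spaces is of class `C^k` on a set
(`k = ∞`: smooth, `k = ω`: real analytic). -/
def EndFieldContMDiffOn [IsManifold 𝓘(ℝ, E) ∞ N] (k : ℕ∞ω)
    (A : Π x : N, TangentSpace 𝓘(ℝ, E) x →L[ℝ] TangentSpace 𝓘(ℝ, E) x) (V : Set N) : Prop :=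
  ContMDiffOn 𝓘(ℝ, E) (𝓘(ℝ, E).prod 𝓘(ℝ, E →L[ℝ] E)) k
    (fun x => TotalSpace.mk' (E →L[ℝ] E)
      (E := fun x : N => TangentSpace 𝓘(ℝ, E) x →L[ℝ] TangentSpace 𝓘(ℝ, E) x) x (A x)) V

/-- The Levi-Civita connection of `g`: torsion-free, and `d(g(X, Y)) = g(∇X, Y) + g(X, ∇Y)`.
Recall that `cov X x v` is `∇_v X` at `x`. -/
structure IsLeviCivita [FiniteDimensional ℝ E] [IsManifold 𝓘(ℝ, E) ∞ N]
    (g : PseudoRiemannianMetric E N)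
    (cov : CovariantDerivative 𝓘(ℝ, E) E (TangentSpace 𝓘(ℝ, E) : N → Type _)) : Prop where
  torsion_eq_zero : haveI : CompleteSpace E := FiniteDimensional.complete ℝ E; cov.torsion = 0
  metric (X Y : Π x : N, TangentSpace 𝓘(ℝ, E) x) (x : N) (v : TangentSpace 𝓘(ℝ, E) x) :
    VectorFieldDiffAt X x → VectorFieldDiffAt Y x →
      (mfderiv 𝓘(ℝ, E) 𝓘(ℝ, ℝ) (fun y => g.inner y (X y) (Y y)) x v : ℝ) =
        g.inner x (cov X x v) (Y x) + g.inner x (X x) (cov Y x v)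

/-- `(∇_v A)_x = B` for a field of endomorphisms `A`, where
`(∇_v A) Y = ∇_v (A Y) - A (∇_v Y)`. -/
def HasCovDerivEnd [IsManifold 𝓘(ℝ, E) ∞ N]
    (cov : CovariantDerivative 𝓘(ℝ, E) E (TangentSpace 𝓘(ℝ, E) : N → Type _))
    (A : Π x : N, TangentSpace 𝓘(ℝ, E) x →L[ℝ] TangentSpace 𝓘(ℝ, E) x)
    (x : N) (v : TangentSpace 𝓘(ℝ, E) x)
    (B : TangentSpace 𝓘(ℝ, E) x →L[ℝ] TangentSpace 𝓘(ℝ, E) x) : Prop :=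
  ∀ Y : Π x : N, TangentSpace 𝓘(ℝ, E) x, VectorFieldDiffAt Y x →
    cov (fun y => A y (Y y)) x v - A x (cov Y x v) = B (Y x)

end Ambient

/-! ## Para-quaternionic Kähler manifolds -/

/-- `J₁, J₂, J₃ = J₁ J₂` anticommute and square to `ε₁, ε₂, ε₃` times the identity. -/
structure IsStandardTriple {V : Type*} [AddCommGroup V] [Module ℝ V] [TopologicalSpace V]
    [IsTopologicalAddGroup V] [ContinuousConstSMul ℝ V]
    (ε₁ ε₂ ε₃ : ℝ) (J₁ J₂ J₃ : V →L[ℝ] V) : Prop where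
  sq₁ : J₁ ∘L J₁ = ε₁ • ContinuousLinearMap.id ℝ V
  sq₂ : J₂ ∘L J₂ = ε₂ • ContinuousLinearMap.id ℝ V
  sq₃ : J₃ ∘L J₃ = ε₃ • ContinuousLinearMap.id ℝ V
  mul : J₃ = J₁ ∘L J₂
  anti₁₂ : J₁ ∘L J₂ = -(J₂ ∘L J₁)
  anti₂₃ : J₂ ∘L J₃ = -(J₃ ∘L J₂)
  anti₃₁ : J₃ ∘L J₁ = -(J₁ ∘L J₃)

/-- Smooth local frame of `Q` on `V` which is a standard triple at each point. -/
structure IsStandardFrameOn {E : Type*} [NormedAddCommGroup E] [NormedSpace ℝ E]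
    {N : Type*} [TopologicalSpace N] [ChartedSpace E N] [IsManifold 𝓘(ℝ, E) ∞ N]
    (Q : Π x : N, Submodule ℝ (TangentSpace 𝓘(ℝ, E) x →L[ℝ] TangentSpace 𝓘(ℝ, E) x))
    (ε₁ ε₂ ε₃ : ℝ) (J₁ J₂ J₃ : Π x : N, TangentSpace 𝓘(ℝ, E) x →L[ℝ] TangentSpace 𝓘(ℝ, E) x)
    (V : Set N) : Prop where
  smooth₁ : EndFieldContMDiffOn ∞ J₁ V
  smooth₂ : EndFieldContMDiffOn ∞ J₂ V
  smooth₃ : EndFieldContMDiffOn ∞ J₃ V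
  triple : ∀ x ∈ V, IsStandardTriple ε₁ ε₂ ε₃ (J₁ x) (J₂ x) (J₃ x)
  span : ∀ x ∈ V, Q x = Submodule.span ℝ {J₁ x, J₂ x, J₃ x}

/-- A para-quaternionic Kähler structure on `N`: a pseudo-Riemannian metric `g`, and a bundle `Q` of
`g`-skew-symmetric endomorphisms, locally generated by standard frames, and preserved by the
Levi-Civita connection `nabla` of `g`. (A standard triple with signs a permutation of `(-1, 1, 1)`
can always be rearranged to have signs `(-1, 1, 1)`. In dimension 4 one often demands a curvature
condition in addition, which is not imposed here.) -/
structure ParaQuaternionicKahlerStructure (E : Type*) [NormedAddCommGroup E] [NormedSpace ℝ E]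
    [FiniteDimensional ℝ E]
    (N : Type*) [TopologicalSpace N] [ChartedSpace E N] [IsManifold 𝓘(ℝ, E) ∞ N] where
  g : PseudoRiemannianMetric E N
  nabla : CovariantDerivative 𝓘(ℝ, E) E (TangentSpace 𝓘(ℝ, E) : N → Type _)
  isLeviCivita : IsLeviCivita g nabla
  Q (x : N) : Submodule ℝ (TangentSpace 𝓘(ℝ, E) x →L[ℝ] TangentSpace 𝓘(ℝ, E) x)
  locally_standard (x : N) : ∃ V : Set N, IsOpen V ∧ x ∈ V ∧
    ∃ J₁ J₂ J₃ : Π x : N, TangentSpace 𝓘(ℝ, E) x →L[ℝ] TangentSpace 𝓘(ℝ, E) x,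
      IsStandardFrameOn Q (-1) 1 1 J₁ J₂ J₃ V
  skew (x : N) (A : TangentSpace 𝓘(ℝ, E) x →L[ℝ] TangentSpace 𝓘(ℝ, E) x) : A ∈ Q x →
    ∀ v w, g.inner x (A v) w = -g.inner x v (A w)
  parallel (V : Set N) (A : Π x : N, TangentSpace 𝓘(ℝ, E) x →L[ℝ] TangentSpace 𝓘(ℝ, E) x) :
    IsOpen V → EndFieldContMDiffOn ∞ A V → (∀ x ∈ V, A x ∈ Q x) →
      ∀ x ∈ V, ∀ v, ∃ B ∈ Q x, HasCovDerivEnd nabla A x v B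

/-- The connection forms `ω₁, ω₂, ω₃` of a frame `J₁, J₂, J₃` on `V`:
`∇ J_α = -ε_β ω_γ ⊗ J_β + ε_γ ω_β ⊗ J_γ` for `(α, β, γ)` a cyclic permutation of `(1, 2, 3)`. -/
structure IsConnectionForms {E : Type*} [NormedAddCommGroup E] [NormedSpace ℝ E]
    {N : Type*} [TopologicalSpace N] [ChartedSpace E N] [IsManifold 𝓘(ℝ, E) ∞ N]
    (cov : CovariantDerivative 𝓘(ℝ, E) E (TangentSpace 𝓘(ℝ, E) : N → Type _))
    (ε₁ ε₂ ε₃ : ℝ) (J₁ J₂ J₃ : Π x : N, TangentSpace 𝓘(ℝ, E) x →L[ℝ] TangentSpace 𝓘(ℝ, E) x)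
    (ω₁ ω₂ ω₃ : Π x : N, TangentSpace 𝓘(ℝ, E) x →L[ℝ] ℝ) (V : Set N) : Prop where
  cov₁ : ∀ x ∈ V, ∀ v, HasCovDerivEnd cov J₁ x v (-(ε₂ * ω₃ x v) • J₂ x + (ε₃ * ω₂ x v) • J₃ x)
  cov₂ : ∀ x ∈ V, ∀ v, HasCovDerivEnd cov J₂ x v (-(ε₃ * ω₁ x v) • J₃ x + (ε₁ * ω₃ x v) • J₁ x)
  cov₃ : ∀ x ∈ V, ∀ v, HasCovDerivEnd cov J₃ x v (-(ε₁ * ω₂ x v) • J₁ x + (ε₂ * ω₁ x v) • J₂ x)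

/-! ## Integrability of an almost `ε`-complex structure -/

section Integrability

variable {F : Type*} [NormedAddCommGroup F] [NormedSpace ℝ F]
  {M : Type*} [TopologicalSpace M] [ChartedSpace F M]

/-- `N_J(X, Y) = [JX, JY] - J[JX, Y] - J[X, JY] + ε [X, Y]` at `x`, for `J² = ε`. -/
def nijenhuis (ε : ℝ) (J : Π x : M, TangentSpace 𝓘(ℝ, F) x →L[ℝ] TangentSpace 𝓘(ℝ, F) x)
    (X Y : Π x : M, TangentSpace 𝓘(ℝ, F) x) (x : M) : TangentSpace 𝓘(ℝ, F) x :=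
  VectorField.mlieBracket 𝓘(ℝ, F) (fun y => J y (X y)) (fun y => J y (Y y)) x
    - J x (VectorField.mlieBracket 𝓘(ℝ, F) (fun y => J y (X y)) Y x)
    - J x (VectorField.mlieBracket 𝓘(ℝ, F) X (fun y => J y (Y y)) x)
    + ε • VectorField.mlieBracket 𝓘(ℝ, F) X Y x

/-- `J` is integrable on `U`: its Nijenhuis tensor vanishes on all smooth vector fields defined on
open subsets of `U`. -/
def IsIntegrableOn [IsManifold 𝓘(ℝ, F) ∞ M] (ε : ℝ)
    (J : Π x : M, TangentSpace 𝓘(ℝ, F) x →L[ℝ] TangentSpace 𝓘(ℝ, F) x) (U : Set M) : Prop :=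
  ∀ V ⊆ U, IsOpen V → ∀ X Y : Π x : M, TangentSpace 𝓘(ℝ, F) x,
    VectorFieldSmoothOn X V → VectorFieldSmoothOn Y V → ∀ x ∈ V, nijenhuis ε J X Y x = 0

end Integrability

/-! ## Almost `ε`-Hermitian submanifolds -/

section Submanifold

variable {E : Type*} [NormedAddCommGroup E] [NormedSpace ℝ E]
  [FiniteDimensional ℝ E]
  {N : Type*} [TopologicalSpace N] [ChartedSpace E N] [IsManifold 𝓘(ℝ, E) ∞ N]

/-- An almost `ε`-Hermitian submanifold `f : M → N` of a para-quaternionic Kähler manifold: an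
(immersed) submanifold with nondegenerate induced metric, together with a smooth section `J` of
`Q` along `M` with `J² = ε` which preserves the tangent spaces of `M`. The endomorphism field `JT`
of `TM` is the restriction of `J` to `TM`. -/
structure AlmostEpsHermitianSubmanifold (P : ParaQuaternionicKahlerStructure E N) (ε : ℝ)
    (F : Type*) [NormedAddCommGroup F] [NormedSpace ℝ F]
    (M : Type*) [TopologicalSpace M] [ChartedSpace F M] [IsManifold 𝓘(ℝ, F) ∞ M] where
  f : M → N
  isImmersion : IsImmersion 𝓘(ℝ, F) 𝓘(ℝ, E) ∞ f
  nondegenerate (x : M) (v : TangentSpace 𝓘(ℝ, F) x) :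
    (∀ w : TangentSpace 𝓘(ℝ, F) x, P.g.inner (f x) (mfderiv 𝓘(ℝ, F) 𝓘(ℝ, E) f x v)
      (mfderiv 𝓘(ℝ, F) 𝓘(ℝ, E) f x w) = 0) → v = 0
  J (x : M) : TangentSpace 𝓘(ℝ, E) (f x) →L[ℝ] TangentSpace 𝓘(ℝ, E) (f x)
  J_smooth : ContMDiff 𝓘(ℝ, F) (𝓘(ℝ, E).prod 𝓘(ℝ, E →L[ℝ] E)) ∞
    (fun x => TotalSpace.mk' (E →L[ℝ] E)
      (E := fun y : N => TangentSpace 𝓘(ℝ, E) y →L[ℝ] TangentSpace 𝓘(ℝ, E) y) (f x) (J x))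
  J_mem (x : M) : J x ∈ P.Q (f x)
  J_sq (x : M) : J x ∘L J x = ε • ContinuousLinearMap.id ℝ (TangentSpace 𝓘(ℝ, E) (f x))
  JT (x : M) : TangentSpace 𝓘(ℝ, F) x →L[ℝ] TangentSpace 𝓘(ℝ, F) x
  JT_spec (x : M) (v : TangentSpace 𝓘(ℝ, F) x) :
    mfderiv 𝓘(ℝ, F) 𝓘(ℝ, E) f x (JT x v) = J x (mfderiv 𝓘(ℝ, F) 𝓘(ℝ, E) f x v)

variable {F : Type*} [NormedAddCommGroup F] [NormedSpace ℝ F]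
  {M : Type*} [TopologicalSpace M] [ChartedSpace F M] [IsManifold 𝓘(ℝ, F) ∞ M]
  {P : ParaQuaternionicKahlerStructure E N} {ε : ℝ}

namespace AlmostEpsHermitianSubmanifold

variable (S : AlmostEpsHermitianSubmanifold P ε F M)

/-- The tangent space of the submanifold at `x`, as a subspace of the ambient tangent space. -/
def tangent (x : M) : Submodule ℝ (TangentSpace 𝓘(ℝ, E) (S.f x)) :=
  LinearMap.range (mfderiv 𝓘(ℝ, F) 𝓘(ℝ, E) S.f x).toLinearMap

/-- A subspace of the ambient tangent space is `Q`-invariant. -/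
def IsQInvariant (x : M) (W : Submodule ℝ (TangentSpace 𝓘(ℝ, E) (S.f x))) : Prop :=
  ∀ A ∈ P.Q (S.f x), ∀ w ∈ W, A w ∈ W

/-- The maximal `Q`-invariant subspace of the tangent space of the submanifold at `x`, as the sum of
all `Q`-invariant subspaces. -/
def maxQInvariant (x : M) : Submodule ℝ (TangentSpace 𝓘(ℝ, E) (S.f x)) :=
  sSup {W | S.IsQInvariant x W ∧ W ≤ S.tangent x}

/-- `D` is a `J`-invariant pure supplement of the maximal `Q`-invariant subspace in the tangent
space of the submanifold at `x`; pure means that `D` contains no nonzero `Q`-invariant subspace. -/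
structure IsPureSupplement (x : M) (D : Submodule ℝ (TangentSpace 𝓘(ℝ, E) (S.f x))) : Prop where
  inf_eq_bot : S.maxQInvariant x ⊓ D = ⊥
  sup_eq : S.maxQInvariant x ⊔ D = S.tangent x
  J_invariant : ∀ w ∈ D, S.J x w ∈ D
  pure : ∀ W ≤ D, S.IsQInvariant x W → W = ⊥

/-- An adapted frame of the submanifold: a standard frame `J₁, J₂, J₃` of `Q` on an open set `V`
of the ambient manifold with `J₂² = 1` such that `J₁` extends `J`, together with its connection
forms. The frame is adapted along the open subset `U` of `M`, where `f` maps `U` to `V` (for an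
embedded `M` one can take `U = f ⁻¹' V`). -/
structure AdaptedFrame where
  U : Set M
  V : Set N
  isOpen_U : IsOpen U
  isOpen_V : IsOpen V
  mapsTo : Set.MapsTo S.f U V
  J₁ (y : N) : TangentSpace 𝓘(ℝ, E) y →L[ℝ] TangentSpace 𝓘(ℝ, E) y
  J₂ (y : N) : TangentSpace 𝓘(ℝ, E) y →L[ℝ] TangentSpace 𝓘(ℝ, E) y
  J₃ (y : N) : TangentSpace 𝓘(ℝ, E) y →L[ℝ] TangentSpace 𝓘(ℝ, E) y
  isFrame : IsStandardFrameOn P.Q ε 1 (-ε) J₁ J₂ J₃ V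
  adapted : ∀ x ∈ U, J₁ (S.f x) = S.J x
  ω₁ (y : N) : TangentSpace 𝓘(ℝ, E) y →L[ℝ] ℝ
  ω₂ (y : N) : TangentSpace 𝓘(ℝ, E) y →L[ℝ] ℝ
  ω₃ (y : N) : TangentSpace 𝓘(ℝ, E) y →L[ℝ] ℝ
  isConnectionForms : IsConnectionForms P.nabla ε 1 (-ε) J₁ J₂ J₃ ω₁ ω₂ ω₃ V

variable {S} in
/-- The local 1-form `ψ = ω₃ ∘ JT - ω₂` on `U ⊆ M`. -/
def AdaptedFrame.psi (Φ : S.AdaptedFrame) (x : M) : TangentSpace 𝓘(ℝ, F) x →L[ℝ] ℝ :=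
  Φ.ω₃ (S.f x) ∘L mfderiv 𝓘(ℝ, F) 𝓘(ℝ, E) S.f x ∘L S.JT x
    - Φ.ω₂ (S.f x) ∘L mfderiv 𝓘(ℝ, F) 𝓘(ℝ, E) S.f x

end AlmostEpsHermitianSubmanifold

end Submanifold

end

/-!
The proof rests on a formula for the Nijenhuis tensor in an adapted frame (`df_nijenhuis`). As the
Levi-Civita connection has no torsion, `N(X, Y)` is a combination of the derivatives of `J₁`, and
inserting the connection forms gives `df N(X, Y) = -J₂ (df Z)`, where
`Z = ψ(X) Y + ε ψ(J X) J Y - ψ(Y) X - ε ψ(J Y) J X`. So `ψ = 0` implies `N = 0`. Conversely, `N = 0`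
implies that `Z = 0` for all `X` and `Y`, and hence that `ψ = 0` because `dim M > 2`.

At any point `N` takes its values in the tangent space of the submanifold, so `Z` takes its values in
the subspace `W` of the tangent vectors which `J₂` keeps tangent. The image of `W` is the maximal
`Q`-invariant subspace (`maxQInvariant_eq`), so a pure supplement of dimension greater than `2` means
that `W` has codimension greater than `2`. By linear algebra (`eq_zero_of_forall_sub_mem`) this forces
`ψ = 0`, and then `N = 0`, at this point: insert an `X` outside `W` with `ψ(X) = ψ(J X) = 0`. For
`ε = 1` such an `X` is needed in each eigenspace of `J`. It exists because the two eigenspaces have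
the same dimension, and so have their intersections with `W`.

It remains to pass from points to the manifold. Around each point there is an adapted frame
(`exists_adaptedFrame`). The vanishing locus of `N` is closed, which settles the case of a dense
open set. In the analytic case, the dimension of `W` is upper semicontinuous
(`eventually_finrank_invariantPart_le`), so `N` vanishes near a point where the supplement has
dimension greater than `2`, and then everywhere by unique continuation.
-/

noncomputable section

/-! ### Skew-symmetric ε-complex structures on vector spaces -/

section LinearAlgebra

variable {V : Type*} [AddCommGroup V] [Module ℝ V] [FiniteDimensional ℝ V]

/-- If `J ^ 2 = 1`, then a `J`-invariant subspace is the direct sum of its `±1`-eigenspaces. -/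
lemma finrank_inf_ker_add_finrank_inf_ker {J : V →ₗ[ℝ] V} (hJ : ∀ v, J (J v) = v)
    (U : Submodule ℝ V) (hU : ∀ v ∈ U, J v ∈ U) :
    finrank ℝ ↥(U ⊓ LinearMap.ker (J - LinearMap.id)) +
      finrank ℝ ↥(U ⊓ LinearMap.ker (J + LinearMap.id)) = finrank ℝ U := by
  have hinf : (U ⊓ LinearMap.ker (J - LinearMap.id)) ⊓ (U ⊓ LinearMap.ker (J + LinearMap.id)) =
      ⊥ := by
    rw [eq_bot_iff]
    rintro v ⟨⟨-, h1⟩, -, h2⟩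
    simp only [SetLike.mem_coe, LinearMap.mem_ker, LinearMap.sub_apply, LinearMap.add_apply,
      LinearMap.id_apply] at h1 h2
    have : (2 : ℝ) • v = 0 := by
      rw [two_smul, ← sub_self (0 : V)]
      nth_rw 1 [← h2, ← h1]
      abel
    simpa using this
  have hsup : (U ⊓ LinearMap.ker (J - LinearMap.id)) ⊔ (U ⊓ LinearMap.ker (J + LinearMap.id)) =
      U := by
    refine le_antisymm (sup_le inf_le_left inf_le_left) fun v hv => ?_
    have : v = (1 / 2 : ℝ) • (v + J v) + (1 / 2 : ℝ) • (v - J v) := by module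
    rw [this]
    refine Submodule.add_mem_sup ⟨U.smul_mem _ (U.add_mem hv (hU v hv)), ?_⟩
      ⟨U.smul_mem _ (U.sub_mem hv (hU v hv)), ?_⟩
    · simp only [SetLike.mem_coe, LinearMap.mem_ker, LinearMap.sub_apply, LinearMap.id_apply,
        map_smul, map_add, hJ]
      module
    · simp only [SetLike.mem_coe, LinearMap.mem_ker, LinearMap.add_apply, LinearMap.id_apply,
        map_smul, map_sub, hJ]
      module
  have := Submodule.finrank_sup_add_finrank_inf_eq (U ⊓ LinearMap.ker (J - LinearMap.id))
    (U ⊓ LinearMap.ker (J + LinearMap.id))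
  rw [hinf, hsup, finrank_bot] at this
  omega

/-- One of two subspaces paired by a bilinear form has at most the dimension of the other if no
nonzero vector of the first is orthogonal to the second. -/
lemma finrank_le_of_pairing (b : V →ₗ[ℝ] V →ₗ[ℝ] ℝ) (A B : Submodule ℝ V)
    (h : ∀ v ∈ A, (∀ w ∈ B, b v w = 0) → v = 0) : finrank ℝ A ≤ finrank ℝ B := by
  rw [← Subspace.dual_finrank_eq (V := B)]
  let T : A →ₗ[ℝ] Module.Dual ℝ B := (LinearMap.lcomp ℝ ℝ B.subtype) ∘ₗ b ∘ₗ A.subtype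
  refine LinearMap.finrank_le_finrank_of_injective (f := T) ?_
  rw [injective_iff_map_eq_zero]
  intro v hv
  apply Subtype.ext
  exact h v v.2 fun w hw => congr($hv ⟨w, hw⟩)

/-- For a skew-symmetric paracomplex structure, the two eigenspaces are isotropic, hence of the same
dimension. -/
lemma finrank_ker_sub_eq_finrank_ker_add {J : V →ₗ[ℝ] V} (hJ : ∀ v, J (J v) = v)
    (b : V →ₗ[ℝ] V →ₗ[ℝ] ℝ) (hb : ∀ v, (∀ w, b v w = 0) → v = 0)
    (hskew : ∀ v w, b (J v) w = -b v (J w)) :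
    finrank ℝ ↥(LinearMap.ker (J - LinearMap.id)) =
      finrank ℝ ↥(LinearMap.ker (J + LinearMap.id)) := by
  have split (w : V) : w = (1 / 2 : ℝ) • (w + J w) + (1 / 2 : ℝ) • (w - J w) := by module
  have memp (w : V) : w + J w ∈ LinearMap.ker (J - LinearMap.id) := by simp [hJ, add_comm]
  have memm (w : V) : w - J w ∈ LinearMap.ker (J + LinearMap.id) := by simp [hJ]
  have hp {v} (h : v ∈ LinearMap.ker (J - LinearMap.id)) : J v = v := by
    simpa [sub_eq_zero] using h
  have hm {v} (h : v ∈ LinearMap.ker (J + LinearMap.id)) : J v = -v := by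
    simpa [add_eq_zero_iff_eq_neg] using h
  apply le_antisymm
  · refine finrank_le_of_pairing b _ _ fun v hv h => hb v fun w => ?_
    have h1 := hskew v (w + J w)
    rw [hp hv, hp (memp w)] at h1
    have h2 := h _ (memm w)
    rw [split w, map_add, map_smul, map_smul, h2]
    simp only [smul_eq_mul]
    linarith
  · refine finrank_le_of_pairing b _ _ fun v hv h => hb v fun w => ?_
    have h1 := hskew v (w - J w)
    rw [hm hv, hm (memm w)] at h1
    simp only [map_neg, LinearMap.neg_apply] at h1
    have h2 := h _ (memp w)
    rw [split w, map_add, map_smul, map_smul, h2]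
    simp only [smul_eq_mul]
    linarith

/-- A functional has nonzero kernel on `A` modulo `B`, if `B` has codimension at least two in `A`. -/
lemma exists_mem_ker_not_mem (A B : Submodule ℝ V) (ψ : V →ₗ[ℝ] ℝ)
    (h : finrank ℝ ↥(B ⊓ A) + 1 < finrank ℝ A) : ∃ v ∈ A, ψ v = 0 ∧ v ∉ B := by
  by_contra! hc
  have h1 : A ⊓ LinearMap.ker ψ ≤ B ⊓ A := fun v hv => ⟨hc v hv.1 hv.2, hv.1⟩
  have h2 := Submodule.finrank_mono h1
  have h3 := LinearMap.finrank_range_add_finrank_ker (ψ.domRestrict A)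
  have h4 : finrank ℝ (LinearMap.range (ψ.domRestrict A)) ≤ 1 := by
    simpa using Submodule.finrank_le (LinearMap.range (ψ.domRestrict A))
  have h5 : finrank ℝ (LinearMap.ker (ψ.domRestrict A)) = finrank ℝ ↥(A ⊓ LinearMap.ker ψ) := by
    rw [LinearMap.ker_domRestrict, ← Submodule.map_comap_subtype]
    exact (Submodule.equivMapOfInjective _ A.subtype_injective _).finrank_eq
  omega

/-- The algebraic heart of the argument. A functional `ψ` on a space with a skew-symmetric
`ε`-complex structure `J` vanishes as soon as
`(ψ X + ε ψ (J X) J) Y - (ψ Y + ε ψ (J Y) J) X` lies, for all `X` and `Y`, in a `J`-invariant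
subspace `W` of codimension more than two (with eigenspaces of `J` of the same dimension if
`ε = 1`): insert a vector `X` outside `W` killed by `ψ` and `ψ ∘ J`, which in the para-complex case
is taken in either eigenspace of `J`. -/
lemma eq_zero_of_forall_sub_mem {ε : ℝ} (hε : ε = 1 ∨ ε = -1) {J : V →ₗ[ℝ] V}
    (hJ : ∀ v, J (J v) = ε • v) (b : V →ₗ[ℝ] V →ₗ[ℝ] ℝ) (hb : ∀ v, (∀ w, b v w = 0) → v = 0)
    (hskew : ∀ v w, b (J v) w = -b v (J w)) (W : Submodule ℝ V) (hW : ∀ v ∈ W, J v ∈ W)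
    (hW₁ : ε = 1 → finrank ℝ ↥(W ⊓ LinearMap.ker (J - LinearMap.id)) =
      finrank ℝ ↥(W ⊓ LinearMap.ker (J + LinearMap.id)))
    (hdim : finrank ℝ W + 2 < finrank ℝ V) (ψ : V →ₗ[ℝ] ℝ)
    (h : ∀ X Y, (ψ X • Y + (ε * ψ (J X)) • J Y) - (ψ Y • X + (ε * ψ (J Y)) • J X) ∈ W) (Y : V) :
    ψ Y = 0 := by
  rcases hε with rfl | rfl
  · have hJ' : ∀ v, J (J v) = v := fun v => by rw [hJ, one_smul]
    have e1 := finrank_ker_sub_eq_finrank_ker_add hJ' b hb hskew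
    have e2 := hW₁ rfl
    have e3 := finrank_inf_ker_add_finrank_inf_ker hJ' W hW
    have e4 := finrank_inf_ker_add_finrank_inf_ker hJ' ⊤ fun _ _ => Submodule.mem_top
    rw [top_inf_eq, top_inf_eq, finrank_top] at e4
    obtain ⟨X, hX, hψX, hXW⟩ := exists_mem_ker_not_mem (LinearMap.ker (J - LinearMap.id)) W ψ
      (by omega)
    obtain ⟨X', hX', hψX', hXW'⟩ := exists_mem_ker_not_mem (LinearMap.ker (J + LinearMap.id)) W ψ
      (by omega)
    have hX : J X = X := by simpa [sub_eq_zero] using hX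
    have hX' : J X' = -X' := by simpa [add_eq_zero_iff_eq_neg] using hX'
    have hp (Z : V) (hZ : J Z = Z) : ψ Z = 0 := by
      by_contra hne
      have := h X Z
      rw [hX, hZ, hψX] at this
      refine hXW ((W.smul_mem_iff (s := -2 * ψ Z) (by simpa using hne)).1 ?_)
      convert this using 1
      module
    have hm (Z : V) (hZ : J Z = -Z) : ψ Z = 0 := by
      by_contra hne
      have := h X' Z
      rw [hX', hZ, map_neg, map_neg, hψX'] at this
      refine hXW' ((W.smul_mem_iff (s := -2 * ψ Z) (by simpa using hne)).1 ?_)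
      convert this using 1
      module
    have h1 := hp (Y + J Y) (by rw [map_add, hJ', add_comm])
    have h2 := hm (Y - J Y) (by rw [map_sub, hJ', neg_sub])
    rw [map_add] at h1
    rw [map_sub] at h2
    linarith
  · have hker : finrank ℝ V ≤ finrank ℝ (LinearMap.ker ψ) + 1 := by
      have h3 := LinearMap.finrank_range_add_finrank_ker ψ
      have h4 : finrank ℝ (LinearMap.range ψ) ≤ 1 := by
        simpa using Submodule.finrank_le (LinearMap.range ψ)
      omega
    have hle := Submodule.finrank_mono (inf_le_left : W ⊓ LinearMap.ker ψ ≤ W)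
    obtain ⟨X, hX, hψX, hXW⟩ := exists_mem_ker_not_mem (LinearMap.ker ψ) W (ψ ∘ₗ J) (by omega)
    rw [LinearMap.mem_ker] at hX
    rw [LinearMap.comp_apply] at hψX
    have h1 := h X Y
    rw [hX, hψX] at h1
    by_contra hne
    refine hXW ((W.smul_mem_iff (s := -(ψ Y ^ 2 + ψ (J Y) ^ 2)) (by
      have : 0 < ψ Y ^ 2 := by positivity
      have := sq_nonneg (ψ (J Y))
      intro h0
      linarith)).1 ?_)
    -- multiply by the conjugate of the complex number `ψ Y - ψ (J Y) J`
    convert W.add_mem (W.smul_mem (ψ Y) h1) (W.smul_mem (ψ (J Y)) (hW _ h1)) using 1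
    simp only [map_sub, map_add, map_smul, hJ]
    module

/-- The maximal subspace `W` of `V` stable under the para-quaternionic structure generated by `I`
and `K`, for an inclusion `D` of `V`, has eigenspaces of the same dimension, as `K` exchanges
them. -/
lemma finrank_comap_inf_ker_eq {E : Type*} [AddCommGroup E] [Module ℝ E] [FiniteDimensional ℝ E]
    {J : V →ₗ[ℝ] V} {D : V →ₗ[ℝ] E} (hD : Function.Injective D) {I K : E →ₗ[ℝ] E}
    (hI : ∀ v, D (J v) = I (D v)) (hIK : ∀ v, I (K v) = -K (I v)) (hK : ∀ v, K (K v) = v)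
    {W : Submodule ℝ V} (hW : ∀ v, v ∈ W ↔ K (D v) ∈ LinearMap.range D) :
    finrank ℝ ↥(W ⊓ LinearMap.ker (J - LinearMap.id)) =
      finrank ℝ ↥(W ⊓ LinearMap.ker (J + LinearMap.id)) := by
  have hKinj : Function.Injective K := Function.LeftInverse.injective (g := K) hK
  have key {A B : Submodule ℝ V} (h : (W ⊓ A).map (K ∘ₗ D) ≤ (W ⊓ B).map D) :
      finrank ℝ ↥(W ⊓ A) ≤ finrank ℝ ↥(W ⊓ B) := by
    rw [(Submodule.equivMapOfInjective (K ∘ₗ D) (hKinj.comp hD) (W ⊓ A)).finrank_eq,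
      (Submodule.equivMapOfInjective D hD (W ⊓ B)).finrank_eq]
    exact Submodule.finrank_mono h
  have aux {v u : V} (hu : D u = K (D v)) : u ∈ W := by
    rw [hW, hu, hK]
    exact ⟨v, rfl⟩
  apply le_antisymm <;> refine key ?_
  · rintro _ ⟨v, ⟨hv, hv'⟩, rfl⟩
    obtain ⟨u, hu⟩ := (hW v).1 hv
    have hv' : J v = v := by simpa [sub_eq_zero] using hv'
    refine ⟨u, ⟨aux hu, ?_⟩, hu⟩
    suffices J u = -u by simpa [add_eq_zero_iff_eq_neg] using this
    apply hD
    rw [hI, hu, hIK, ← hI, hv', map_neg, hu]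
  · rintro _ ⟨v, ⟨hv, hv'⟩, rfl⟩
    obtain ⟨u, hu⟩ := (hW v).1 hv
    have hv' : J v = -v := by simpa [add_eq_zero_iff_eq_neg] using hv'
    refine ⟨u, ⟨aux hu, ?_⟩, hu⟩
    suffices J u = u by simpa [sub_eq_zero] using this
    apply hD
    rw [hI, hu, hIK, ← hI, hv', map_neg, map_neg, neg_neg]

end LinearAlgebra

/-! ### Vector fields and Lie brackets in coordinates -/

section Coordinates

variable {F : Type*} [NormedAddCommGroup F] [NormedSpace ℝ F]
  {M : Type*} [TopologicalSpace M] [ChartedSpace F M]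

lemma extChartAt_symm_mem_source {x₀ : M} {u : F} (hu : u ∈ (extChartAt 𝓘(ℝ, F) x₀).target) :
    (extChartAt 𝓘(ℝ, F) x₀).symm u ∈ (chartAt F x₀).source := by
  rw [← extChartAt_source 𝓘(ℝ, F)]
  exact (extChartAt 𝓘(ℝ, F) x₀).map_target hu

lemma contMDiffAt_extChartAt_symm' {k : ℕ∞ω} [IsManifold 𝓘(ℝ, F) k M] {x₀ : M} {u : F}
    (hu : u ∈ (extChartAt 𝓘(ℝ, F) x₀).target) :
    ContMDiffAt 𝓘(ℝ, F) 𝓘(ℝ, F) k (extChartAt 𝓘(ℝ, F) x₀).symm u :=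
  (contMDiffOn_extChartAt_symm x₀).contMDiffAt ((isOpen_extChartAt_target x₀).mem_nhds hu)

variable [IsManifold 𝓘(ℝ, F) ∞ M]

/-- Coordinates on the tangent space at `y`, in the chart at `x₀`. -/
def tangentCoord (x₀ y : M) : TangentSpace 𝓘(ℝ, F) y →L[ℝ] F :=
  (trivializationAt F (TangentSpace 𝓘(ℝ, F) : M → Type _) x₀).continuousLinearMapAt ℝ y

/-- The tangent vector at `y` with given coordinates in the chart at `x₀`. -/
def tangentCoordSymm (x₀ y : M) : F →L[ℝ] TangentSpace 𝓘(ℝ, F) y :=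
  (trivializationAt F (TangentSpace 𝓘(ℝ, F) : M → Type _) x₀).symmL ℝ y

lemma mem_baseSet_of_mem_source {x₀ y : M} (hy : y ∈ (chartAt F x₀).source) :
    y ∈ (trivializationAt F (TangentSpace 𝓘(ℝ, F) : M → Type _) x₀).baseSet := by
  simpa using hy

lemma tangentCoord_apply {x₀ y : M} (hy : y ∈ (chartAt F x₀).source)
    (v : TangentSpace 𝓘(ℝ, F) y) : tangentCoord x₀ y v =
      (trivializationAt F (TangentSpace 𝓘(ℝ, F) : M → Type _) x₀ ⟨y, v⟩).2 :=
  Trivialization.continuousLinearMapAt_apply_of_mem (R := ℝ) _ (mem_baseSet_of_mem_source hy) v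

lemma tangentCoord_symm {x₀ y : M} (hy : y ∈ (chartAt F x₀).source) (v : F) :
    tangentCoord x₀ y (tangentCoordSymm x₀ y v) = v :=
  (trivializationAt F (TangentSpace 𝓘(ℝ, F) : M → Type _) x₀).continuousLinearMapAt_symmL
    (mem_baseSet_of_mem_source hy) v

lemma tangentCoordSymm_coord {x₀ y : M} (hy : y ∈ (chartAt F x₀).source)
    (v : TangentSpace 𝓘(ℝ, F) y) : tangentCoordSymm x₀ y (tangentCoord x₀ y v) = v :=
  (trivializationAt F (TangentSpace 𝓘(ℝ, F) : M → Type _) x₀).symmL_continuousLinearMapAt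
    (mem_baseSet_of_mem_source hy) v

lemma tangentCoord_injective {x₀ y : M} (hy : y ∈ (chartAt F x₀).source) :
    Function.Injective (tangentCoord (F := F) x₀ y) :=
  Function.LeftInverse.injective (g := tangentCoordSymm x₀ y) (tangentCoordSymm_coord hy)

lemma tangentCoord_eq_mfderiv {x₀ y : M} (hy : y ∈ (chartAt F x₀).source) :
    tangentCoord x₀ y = mfderiv 𝓘(ℝ, F) 𝓘(ℝ, F) (extChartAt 𝓘(ℝ, F) x₀) y :=
  TangentBundle.continuousLinearMapAt_trivializationAt hy

lemma mdifferentiableAt_extChartAt_symm {x₀ : M} {u : F}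
    (hu : u ∈ (extChartAt 𝓘(ℝ, F) x₀).target) :
    MDifferentiableAt 𝓘(ℝ, F) 𝓘(ℝ, F) (extChartAt 𝓘(ℝ, F) x₀).symm u := by
  have := mdifferentiableWithinAt_extChartAt_symm hu
  rwa [modelWithCornersSelf_coe, Set.range_id, mdifferentiableWithinAt_univ] at this

lemma tangentCoordSymm_eq_mfderiv {x₀ : M} {u : F} (hu : u ∈ (extChartAt 𝓘(ℝ, F) x₀).target) :
    tangentCoordSymm (F := F) x₀ ((extChartAt 𝓘(ℝ, F) x₀).symm u) =
      mfderiv 𝓘(ℝ, F) 𝓘(ℝ, F) (extChartAt 𝓘(ℝ, F) x₀).symm u := by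
  have := TangentBundle.symmL_trivializationAt (I := 𝓘(ℝ, F)) (extChartAt_symm_mem_source hu)
  rw [(extChartAt 𝓘(ℝ, F) x₀).right_inv hu, modelWithCornersSelf_coe, Set.range_id,
    mfderivWithin_univ] at this
  exact this

/-- A vector field in the coordinates of the chart at `x₀`. -/
def fieldCoord (x₀ : M) (X : Π y : M, TangentSpace 𝓘(ℝ, F) y) (u : F) : F :=
  tangentCoord x₀ ((extChartAt 𝓘(ℝ, F) x₀).symm u) (X ((extChartAt 𝓘(ℝ, F) x₀).symm u))

lemma differentiableAt_fieldCoord {x₀ : M} {u : F} (hu : u ∈ (extChartAt 𝓘(ℝ, F) x₀).target)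
    {X : Π y : M, TangentSpace 𝓘(ℝ, F) y}
    (hX : VectorFieldDiffAt X ((extChartAt 𝓘(ℝ, F) x₀).symm u)) :
    DifferentiableAt ℝ (fieldCoord x₀ X) u := by
  have h := ((trivializationAt F (TangentSpace 𝓘(ℝ, F) : M → Type _)
    x₀).mdifferentiableAt_section_iff 𝓘(ℝ, F) X
    (mem_baseSet_of_mem_source (extChartAt_symm_mem_source hu))).1 hX
  have h2 := (h.comp u (mdifferentiableAt_extChartAt_symm hu)).differentiableAt
  refine h2.congr_of_eventuallyEq ?_
  filter_upwards [(isOpen_extChartAt_target x₀).mem_nhds hu] with z hz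
  exact tangentCoord_apply (extChartAt_symm_mem_source hz) _

lemma tangentCoord_mlieBracket [CompleteSpace F] {x₀ : M} {u : F}
    (hu : u ∈ (extChartAt 𝓘(ℝ, F) x₀).target) {X Y : Π y : M, TangentSpace 𝓘(ℝ, F) y}
    (hX : VectorFieldDiffAt X ((extChartAt 𝓘(ℝ, F) x₀).symm u))
    (hY : VectorFieldDiffAt Y ((extChartAt 𝓘(ℝ, F) x₀).symm u)) :
    fieldCoord x₀ (VectorField.mlieBracket 𝓘(ℝ, F) X Y) u =
      VectorField.lieBracket ℝ (fieldCoord x₀ X) (fieldCoord x₀ Y) u := by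
  have hle : (2 : ℕ∞ω) ≤ ∞ := ENat.LEInfty.out
  have : IsManifold 𝓘(ℝ, F) (minSmoothness ℝ 2) M := by
    rw [minSmoothness_of_isRCLikeNormedField]
    exact IsManifold.of_le hle
  have key (Z : Π y : M, TangentSpace 𝓘(ℝ, F) y) {w : F}
      (hw : w ∈ (extChartAt 𝓘(ℝ, F) x₀).target) :
      VectorField.mpullback 𝓘(ℝ, F) 𝓘(ℝ, F) (extChartAt 𝓘(ℝ, F) x₀).symm Z w =
        fieldCoord x₀ Z w := by
    rw [VectorField.mpullback_apply, fieldCoord, ← tangentCoordSymm_eq_mfderiv hw]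
    congr 1
    exact ContinuousLinearMap.inverse_eq
      (by ext v; exact tangentCoordSymm_coord (extChartAt_symm_mem_source hw) v)
      (by ext v; exact tangentCoord_symm (extChartAt_symm_mem_source hw) v)
  rw [← key _ hu, VectorField.mpullback_mlieBracket (n := ∞) hX hY
    (contMDiffAt_extChartAt_symm' hu) (by rw [minSmoothness_of_isRCLikeNormedField]; exact hle),
    ← VectorField.mlieBracketWithin_univ, VectorField.mlieBracketWithin_eq_lieBracketWithin]
  refine (congrFun VectorField.lieBracketWithin_univ u).trans ?_
  apply Filter.EventuallyEq.lieBracket_vectorField_eq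
  all_goals
    filter_upwards [(isOpen_extChartAt_target x₀).mem_nhds hu] with z hz using key _ hz

end Coordinates

section RelatedFields

/-- Related vector fields on normed spaces have related Lie brackets. -/
lemma fderiv_lieBracket_of_related {F E : Type*} [NormedAddCommGroup F] [NormedSpace ℝ F]
    [NormedAddCommGroup E] [NormedSpace ℝ E] {f : F → E} {u : F} (hf : ContDiffAt ℝ 2 f u)
    {V W : F → F} {V' W' : E → E} (hV : DifferentiableAt ℝ V u) (hW : DifferentiableAt ℝ W u)
    (hV' : DifferentiableAt ℝ V' (f u)) (hW' : DifferentiableAt ℝ W' (f u))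
    (hVV : ∀ᶠ z in 𝓝 u, V' (f z) = fderiv ℝ f z (V z))
    (hWW : ∀ᶠ z in 𝓝 u, W' (f z) = fderiv ℝ f z (W z)) :
    fderiv ℝ f u (VectorField.lieBracket ℝ V W u) = VectorField.lieBracket ℝ V' W' (f u) := by
  have hdf : DifferentiableAt ℝ (fderiv ℝ f) u :=
    (hf.fderiv_right (m := 1) (by norm_num)).differentiableAt (by norm_num)
  have hfd : DifferentiableAt ℝ f u := hf.differentiableAt (by norm_num)
  have hsymm : IsSymmSndFDerivAt ℝ f u := hf.isSymmSndFDerivAt (by simp)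
  have key {Z : F → F} {Z' : E → E} (hZ : DifferentiableAt ℝ Z u)
      (hZ' : DifferentiableAt ℝ Z' (f u)) (h : ∀ᶠ z in 𝓝 u, Z' (f z) = fderiv ℝ f z (Z z))
      (v : F) : fderiv ℝ Z' (f u) (fderiv ℝ f u v) =
        fderiv ℝ (fderiv ℝ f) u v (Z u) + fderiv ℝ f u (fderiv ℝ Z u v) := by
    have h1 := (hZ'.hasFDerivAt.comp u hfd.hasFDerivAt).congr_of_eventuallyEq
      (f₁ := fun z => fderiv ℝ f z (Z z)) (by filter_upwards [h] with z hz using hz.symm)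
    have h2 := hdf.hasFDerivAt.clm_apply hZ.hasFDerivAt
    have := congr($(h1.unique h2) v)
    simpa [add_comm] using this
  rw [VectorField.lieBracket, VectorField.lieBracket, hVV.self_of_nhds, hWW.self_of_nhds,
    key hW hW' hWW, key hV hV' hVV, hsymm.eq (V u) (W u), map_sub]
  abel

variable {F : Type*} [NormedAddCommGroup F] [NormedSpace ℝ F] [CompleteSpace F]
  {M : Type*} [TopologicalSpace M] [ChartedSpace F M] [IsManifold 𝓘(ℝ, F) ∞ M]
  {E : Type*} [NormedAddCommGroup E] [NormedSpace ℝ E] [CompleteSpace E]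
  {N : Type*} [TopologicalSpace N] [ChartedSpace E N] [IsManifold 𝓘(ℝ, E) ∞ N]

/-- Related vector fields have related Lie brackets. -/
lemma mfderiv_mlieBracket_of_related {f : M → N} {x : M}
    (hf : ContMDiff 𝓘(ℝ, F) 𝓘(ℝ, E) ∞ f) {X Y : Π y : M, TangentSpace 𝓘(ℝ, F) y}
    {X' Y' : Π z : N, TangentSpace 𝓘(ℝ, E) z} (hX : VectorFieldDiffAt X x)
    (hY : VectorFieldDiffAt Y x) (hX' : VectorFieldDiffAt X' (f x))
    (hY' : VectorFieldDiffAt Y' (f x))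
    (hXX : ∀ᶠ y in 𝓝 x, X' (f y) = mfderiv 𝓘(ℝ, F) 𝓘(ℝ, E) f y (X y))
    (hYY : ∀ᶠ y in 𝓝 x, Y' (f y) = mfderiv 𝓘(ℝ, F) 𝓘(ℝ, E) f y (Y y)) :
    mfderiv 𝓘(ℝ, F) 𝓘(ℝ, E) f x (VectorField.mlieBracket 𝓘(ℝ, F) X Y x) =
      VectorField.mlieBracket 𝓘(ℝ, E) X' Y' (f x) := by
  set φ := extChartAt 𝓘(ℝ, F) x with hφ
  set χ := extChartAt 𝓘(ℝ, E) (f x) with hχ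
  obtain ⟨u, hu, hxu⟩ : ∃ u ∈ φ.target, φ.symm u = x :=
    ⟨φ x, mem_extChartAt_target x, extChartAt_to_inv x⟩
  -- the coordinate expression of `f`
  set fc : F → E := fun z => χ (f (φ.symm z)) with hfc
  have hcont : ContinuousAt (fun z => f (φ.symm z)) u :=
    hf.continuous.continuousAt.comp
      ((continuousOn_extChartAt_symm x).continuousAt ((isOpen_extChartAt_target x).mem_nhds hu))
  have hnear : ∀ᶠ z in 𝓝 u, z ∈ φ.target ∧ f (φ.symm z) ∈ (chartAt E (f x)).source :=
    Filter.Eventually.and ((isOpen_extChartAt_target x).mem_nhds hu)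
      (hcont.preimage_mem_nhds ((chartAt E (f x)).open_source.mem_nhds (by
        simp only [hxu]; exact mem_chart_source E (f x))))
  have hfcd {z : F} (hz : z ∈ φ.target) (hz' : f (φ.symm z) ∈ (chartAt E (f x)).source) (v : F) :
      fderiv ℝ fc z v = tangentCoord (f x) (f (φ.symm z))
        (mfderiv 𝓘(ℝ, F) 𝓘(ℝ, E) f (φ.symm z) (tangentCoordSymm x (φ.symm z) v)) := by
    rw [tangentCoordSymm_eq_mfderiv hz, tangentCoord_eq_mfderiv hz']
    have h1 : HasMFDerivAt 𝓘(ℝ, F) 𝓘(ℝ, E) fc z _ :=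
      ((mdifferentiableAt_extChartAt (I := 𝓘(ℝ, E)) hz').hasMFDerivAt).comp z
        (((hf.mdifferentiable (by simp)) (φ.symm z)).hasMFDerivAt.comp z
          (mdifferentiableAt_extChartAt_symm hz).hasMFDerivAt)
    rw [← mfderiv_eq_fderiv, h1.mfderiv]
    rfl
  have hfcs : ContDiffAt ℝ 2 fc u := by
    have h1 : ContMDiffAt 𝓘(ℝ, F) 𝓘(ℝ, E) ∞ fc u :=
      (contMDiffAt_extChartAt' (by rw [hxu]; exact mem_chart_source E (f x))).comp u
        ((hf _).comp u (contMDiffAt_extChartAt_symm' hu))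
    exact h1.contDiffAt.of_le ENat.LEInfty.out
  have hχf {y : M} (hy : f y ∈ (chartAt E (f x)).source) : χ.symm (χ (f y)) = f y :=
    χ.left_inv (by rw [hχ, extChartAt_source]; exact hy)
  have hrel {Z : Π y : M, TangentSpace 𝓘(ℝ, F) y} {Z' : Π z : N, TangentSpace 𝓘(ℝ, E) z}
      (h : ∀ᶠ y in 𝓝 x, Z' (f y) = mfderiv 𝓘(ℝ, F) 𝓘(ℝ, E) f y (Z y)) :
      ∀ᶠ z in 𝓝 u, fieldCoord (f x) Z' (fc z) = fderiv ℝ fc z (fieldCoord x Z z) := by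
    have hc : Filter.Tendsto φ.symm (𝓝 u) (𝓝 x) := by
      have := (continuousOn_extChartAt_symm (I := 𝓘(ℝ, F)) x).continuousAt
        ((isOpen_extChartAt_target x).mem_nhds hu)
      rwa [ContinuousAt, ← hφ, hxu] at this
    filter_upwards [hnear, hc.eventually h] with z hz h1
    rw [hfcd hz.1 hz.2, fieldCoord, fieldCoord, tangentCoordSymm_coord
      (extChartAt_symm_mem_source hz.1), ← h1, hfc, hχf hz.2]
  have hfu : χ.symm (fc u) = f x := by rw [hfc]; simp only [hxu]; exact extChartAt_to_inv (f x)
  have hfut : fc u ∈ χ.target := by rw [hfc]; simp only [hxu]; exact mem_extChartAt_target (f x)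
  have e1 := fderiv_lieBracket_of_related hfcs
    (differentiableAt_fieldCoord hu (X := X) (by rwa [← hφ, hxu]))
    (differentiableAt_fieldCoord hu (X := Y) (by rwa [← hφ, hxu]))
    (differentiableAt_fieldCoord hfut (X := X') (by rwa [← hχ, hfu]))
    (differentiableAt_fieldCoord hfut (X := Y') (by rwa [← hχ, hfu])) (hrel hXX) (hrel hYY)
  rw [← tangentCoord_mlieBracket hu (by rwa [← hφ, hxu]) (by rwa [← hφ, hxu]),
    ← tangentCoord_mlieBracket hfut (by rwa [← hχ, hfu]) (by rwa [← hχ, hfu]),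
    hfcd hu (by rw [hxu]; exact mem_chart_source E (f x)), fieldCoord, fieldCoord, ← hφ, ← hχ,
    tangentCoordSymm_coord (extChartAt_symm_mem_source hu), hfu, hxu] at e1
  exact tangentCoord_injective (mem_chart_source E (f x)) e1

end RelatedFields

/-! ### The Nijenhuis tensor in coordinates -/

section NijenhuisCoordinates

variable {F : Type*} [NormedAddCommGroup F] [NormedSpace ℝ F]
  {M : Type*} [TopologicalSpace M] [ChartedSpace F M] [IsManifold 𝓘(ℝ, F) ∞ M]

/-- A field of endomorphisms in the coordinates of the chart at `x₀`. -/
def endCoord (x₀ : M) (A : Π y : M, TangentSpace 𝓘(ℝ, F) y →L[ℝ] TangentSpace 𝓘(ℝ, F) y) (u : F) :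
    F →L[ℝ] F :=
  tangentCoord x₀ ((extChartAt 𝓘(ℝ, F) x₀).symm u) ∘L A ((extChartAt 𝓘(ℝ, F) x₀).symm u) ∘L
    tangentCoordSymm x₀ ((extChartAt 𝓘(ℝ, F) x₀).symm u)

lemma contDiffAt_endCoord {k : ℕ∞ω} [IsManifold 𝓘(ℝ, F) k M] [IsManifold 𝓘(ℝ, F) (k + 1) M]
    {x₀ : M} {u : F}
    (hu : u ∈ (extChartAt 𝓘(ℝ, F) x₀).target)
    {A : Π y : M, TangentSpace 𝓘(ℝ, F) y →L[ℝ] TangentSpace 𝓘(ℝ, F) y}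
    (hA : EndFieldContMDiffOn k A Set.univ) : ContDiffAt ℝ k (endCoord x₀ A) u := by
  have : ContMDiffVectorBundle k F (TangentSpace 𝓘(ℝ, F) : M → Type _) 𝓘(ℝ, F) :=
    TangentBundle.contMDiffVectorBundle
  have h0 := hA.contMDiffAt (Filter.univ_mem (f := 𝓝 ((extChartAt 𝓘(ℝ, F) x₀).symm u)))
  have hb := mem_baseSet_of_mem_source (extChartAt_symm_mem_source hu)
  have h := ((trivializationAt (F →L[ℝ] F) (fun x : M =>
    TangentSpace 𝓘(ℝ, F) x →L[ℝ] TangentSpace 𝓘(ℝ, F) x) x₀).contMDiffAt_section_iff (IB := 𝓘(ℝ, F))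
    (by rw [hom_trivializationAt_baseSet]; exact ⟨hb, hb⟩)).1 h0
  exact (h.comp u (contMDiffAt_extChartAt_symm' hu)).contDiffAt

/-- The Nijenhuis tensor of a field of endomorphisms of a normed space, evaluated on the constant
vector fields `v` and `w`. -/
def nijenhuisCoord (A : F → F →L[ℝ] F) (u v w : F) : F :=
  fderiv ℝ A u (A u v) w - fderiv ℝ A u (A u w) v - A u (fderiv ℝ A u v w)
    + A u (fderiv ℝ A u w v)

lemma vectorFieldDiffAt_endField {A : Π y : M, TangentSpace 𝓘(ℝ, F) y →L[ℝ] TangentSpace 𝓘(ℝ, F) y}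
    {V : Set M} (hA : EndFieldContMDiffOn ∞ A V) {x : M} (hV : V ∈ 𝓝 x)
    {X : Π y : M, TangentSpace 𝓘(ℝ, F) y} (hX : VectorFieldDiffAt X x) :
    VectorFieldDiffAt (fun y => A y (X y)) x :=
  ((hA.contMDiffAt hV).mdifferentiableAt (by simp)).clm_bundle_apply hX

lemma fieldCoord_nijenhuis [CompleteSpace F] {ε : ℝ}
    {A : Π y : M, TangentSpace 𝓘(ℝ, F) y →L[ℝ] TangentSpace 𝓘(ℝ, F) y}
    (hA : EndFieldContMDiffOn ∞ A Set.univ) (hsq : ∀ y v, A y (A y v) = ε • v) {x₀ : M} {u : F}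
    (hu : u ∈ (extChartAt 𝓘(ℝ, F) x₀).target) {X Y : Π y : M, TangentSpace 𝓘(ℝ, F) y}
    (hX : VectorFieldDiffAt X ((extChartAt 𝓘(ℝ, F) x₀).symm u))
    (hY : VectorFieldDiffAt Y ((extChartAt 𝓘(ℝ, F) x₀).symm u)) :
    fieldCoord x₀ (nijenhuis ε A X Y) u =
      nijenhuisCoord (endCoord x₀ A) u (fieldCoord x₀ X u) (fieldCoord x₀ Y u) := by
  have : IsManifold 𝓘(ℝ, F) (∞ + 1) M := ‹IsManifold 𝓘(ℝ, F) ∞ M›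
  have hAX := vectorFieldDiffAt_endField hA Filter.univ_mem hX
  have hAY := vectorFieldDiffAt_endField hA Filter.univ_mem hY
  have hAd : DifferentiableAt ℝ (endCoord x₀ A) u :=
    (contDiffAt_endCoord hu hA).differentiableAt (by simp)
  have hXd := differentiableAt_fieldCoord hu hX
  have hYd := differentiableAt_fieldCoord hu hY
  have happ (Z : Π y : M, TangentSpace 𝓘(ℝ, F) y) {z : F}
      (hz : z ∈ (extChartAt 𝓘(ℝ, F) x₀).target) :
      fieldCoord x₀ (fun y => A y (Z y)) z = endCoord x₀ A z (fieldCoord x₀ Z z) := by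
    simp only [fieldCoord, endCoord, ContinuousLinearMap.comp_apply,
      tangentCoordSymm_coord (extChartAt_symm_mem_source hz)]
  have happ' (Z : Π y : M, TangentSpace 𝓘(ℝ, F) y) :
      fieldCoord x₀ (fun y => A y (Z y)) =ᶠ[𝓝 u] fun z => endCoord x₀ A z (fieldCoord x₀ Z z) := by
    filter_upwards [(isOpen_extChartAt_target x₀).mem_nhds hu] with z hz using happ Z hz
  have hder {Z : Π y : M, TangentSpace 𝓘(ℝ, F) y} (hZ : DifferentiableAt ℝ (fieldCoord x₀ Z) u)
      (v : F) : fderiv ℝ (fieldCoord x₀ (fun y => A y (Z y))) u v =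
        fderiv ℝ (endCoord x₀ A) u v (fieldCoord x₀ Z u)
          + endCoord x₀ A u (fderiv ℝ (fieldCoord x₀ Z) u v) := by
    rw [(happ' Z).fderiv_eq, (hAd.hasFDerivAt.clm_apply hZ.hasFDerivAt).fderiv]
    simp [add_comm]
  have hsq' (v : F) : endCoord x₀ A u (endCoord x₀ A u v) = ε • v := by
    simp only [endCoord, ContinuousLinearMap.comp_apply,
      tangentCoordSymm_coord (extChartAt_symm_mem_source hu), hsq, map_smul,
      tangentCoord_symm (extChartAt_symm_mem_source hu)]
  have e1 := tangentCoord_mlieBracket hu hAX hAY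
  have e2 := tangentCoord_mlieBracket hu hAX hY
  have e3 := tangentCoord_mlieBracket hu hX hAY
  have e4 := tangentCoord_mlieBracket hu hX hY
  have expand : fieldCoord x₀ (nijenhuis ε A X Y) u =
      fieldCoord x₀ (VectorField.mlieBracket 𝓘(ℝ, F) (fun y => A y (X y)) (fun y => A y (Y y))) u
      - fieldCoord x₀ (fun y => A y
          (VectorField.mlieBracket 𝓘(ℝ, F) (fun y => A y (X y)) Y y)) u
      - fieldCoord x₀ (fun y => A y
          (VectorField.mlieBracket 𝓘(ℝ, F) X (fun y => A y (Y y)) y)) u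
      + ε • fieldCoord x₀ (VectorField.mlieBracket 𝓘(ℝ, F) X Y) u := by
    simp only [fieldCoord, nijenhuis, map_sub, map_add, map_smul]
  rw [expand, happ _ hu, happ _ hu, e1, e2, e3, e4]
  simp only [VectorField.lieBracket, hder hXd, hder hYd, happ _ hu, map_sub, map_add, hsq',
    nijenhuisCoord, smul_sub]
  abel

/-- The vector field with constant coordinates `v` in the chart at `x₀`. -/
def constField (x₀ : M) (v : F) (y : M) : TangentSpace 𝓘(ℝ, F) y := tangentCoordSymm x₀ y v

lemma vectorFieldSmoothOn_constField (x₀ : M) (v : F) :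
    VectorFieldSmoothOn (constField x₀ v) (chartAt F x₀).source := by
  intro y hy
  refine ContMDiffAt.contMDiffWithinAt ?_
  refine ((trivializationAt F (TangentSpace 𝓘(ℝ, F) : M → Type _)
    x₀).contMDiffAt_section_iff (mem_baseSet_of_mem_source hy)).2 ?_
  refine (contMDiffAt_const (c := v)).congr_of_eventuallyEq ?_
  filter_upwards [(chartAt F x₀).open_source.mem_nhds hy] with z hz
  exact (tangentCoord_apply hz _).symm.trans (tangentCoord_symm hz v)

lemma vectorFieldDiffAt_constField {x₀ y : M} (hy : y ∈ (chartAt F x₀).source) (v : F) :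
    VectorFieldDiffAt (constField x₀ v) y :=
  ((vectorFieldSmoothOn_constField x₀ v).contMDiffAt
    ((chartAt F x₀).open_source.mem_nhds hy)).mdifferentiableAt (by simp)

lemma fieldCoord_constField {x₀ : M} {u : F} (hu : u ∈ (extChartAt 𝓘(ℝ, F) x₀).target) (v : F) :
    fieldCoord x₀ (constField x₀ v) u = v :=
  tangentCoord_symm (extChartAt_symm_mem_source hu) v

lemma continuousOn_nijenhuisCoord {J : Π y : M, TangentSpace 𝓘(ℝ, F) y →L[ℝ] TangentSpace 𝓘(ℝ, F) y}
    (hJ : EndFieldContMDiffOn ∞ J Set.univ) (x₀ : M) (v w : F) :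
    ContinuousOn (fun u => nijenhuisCoord (endCoord x₀ J) u v w)
      (extChartAt 𝓘(ℝ, F) x₀).target := by
  intro u hu
  have : IsManifold 𝓘(ℝ, F) (∞ + 1) M := ‹IsManifold 𝓘(ℝ, F) ∞ M›
  have h0 := contDiffAt_endCoord (k := ∞) hu hJ
  have h1 : ContinuousAt (endCoord x₀ J) u := h0.continuousAt
  have h2 : ContinuousAt (fderiv ℝ (endCoord x₀ J)) u :=
    (h0.fderiv_right (m := 0) (by simp)).continuousAt
  have c {f : F → F →L[ℝ] F} (hf : ContinuousAt f u) {z : F → F} (hz : ContinuousAt z u) :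
      ContinuousAt (fun u => f u (z u)) u := hf.clm_apply hz
  refine ContinuousAt.continuousWithinAt ?_
  unfold nijenhuisCoord
  fun_prop

/-- Every tangent vector at `x` is the value of a differentiable vector field. -/
lemma exists_vectorField_eq {x : M} (v : TangentSpace 𝓘(ℝ, F) x) :
    ∃ X : Π y : M, TangentSpace 𝓘(ℝ, F) y, VectorFieldDiffAt X x ∧ X x = v :=
  ⟨constField x (tangentCoord x x v), vectorFieldDiffAt_constField (mem_chart_source F x) _,
    tangentCoordSymm_coord (mem_chart_source F x) v⟩

/-- The Nijenhuis tensor of `J` vanishes at `x`. -/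
def NijenhuisVanishesAt (ε : ℝ)
    (J : Π x : M, TangentSpace 𝓘(ℝ, F) x →L[ℝ] TangentSpace 𝓘(ℝ, F) x) (x : M) : Prop :=
  ∀ X Y : Π x : M, TangentSpace 𝓘(ℝ, F) x, VectorFieldDiffAt X x → VectorFieldDiffAt Y x →
    nijenhuis ε J X Y x = 0

variable [CompleteSpace F] {ε : ℝ}
  {J : Π y : M, TangentSpace 𝓘(ℝ, F) y →L[ℝ] TangentSpace 𝓘(ℝ, F) y}

lemma nijenhuisVanishesAt_iff_nijenhuisCoord (hJ : EndFieldContMDiffOn ∞ J Set.univ)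
    (hsq : ∀ y v, J y (J y v) = ε • v) {x₀ : M} {u : F}
    (hu : u ∈ (extChartAt 𝓘(ℝ, F) x₀).target) :
    NijenhuisVanishesAt ε J ((extChartAt 𝓘(ℝ, F) x₀).symm u) ↔
      ∀ v w, nijenhuisCoord (endCoord x₀ J) u v w = 0 := by
  have hus := extChartAt_symm_mem_source hu
  constructor
  · intro h v w
    have hv := vectorFieldDiffAt_constField hus v
    have hw := vectorFieldDiffAt_constField hus w
    have := fieldCoord_nijenhuis hJ hsq hu hv hw
    rw [fieldCoord_constField hu, fieldCoord_constField hu, fieldCoord, h _ _ hv hw, map_zero]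
      at this
    exact this.symm
  · intro h X Y hX hY
    have := fieldCoord_nijenhuis hJ hsq hu hX hY
    rw [h] at this
    exact tangentCoord_injective hus (this.trans (map_zero _).symm)

lemma isIntegrableOn_iff (hJ : EndFieldContMDiffOn ∞ J Set.univ)
    (hsq : ∀ y v, J y (J y v) = ε • v) {U : Set M} (hU : IsOpen U) :
    IsIntegrableOn ε J U ↔ ∀ x ∈ U, NijenhuisVanishesAt ε J x := by
  constructor
  · intro h x hx
    have hV : IsOpen (U ∩ (chartAt F x).source) := hU.inter (chartAt F x).open_source
    have hxx : (extChartAt 𝓘(ℝ, F) x).symm (extChartAt 𝓘(ℝ, F) x x) = x := extChartAt_to_inv x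
    rw [← hxx, nijenhuisVanishesAt_iff_nijenhuisCoord hJ hsq (mem_extChartAt_target x)]
    intro v w
    have h0 := h _ Set.inter_subset_left hV _ _
      ((vectorFieldSmoothOn_constField x v).mono Set.inter_subset_right)
      ((vectorFieldSmoothOn_constField x w).mono Set.inter_subset_right) x
      ⟨hx, mem_chart_source F x⟩
    have hu := mem_extChartAt_target (I := 𝓘(ℝ, F)) x
    have hus := extChartAt_symm_mem_source hu
    have := fieldCoord_nijenhuis hJ hsq hu (vectorFieldDiffAt_constField hus v)
      (vectorFieldDiffAt_constField hus w)
    rw [fieldCoord_constField hu, fieldCoord_constField hu, fieldCoord, hxx, h0, map_zero] at this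
    exact this.symm
  · intro h V hVU hV X Y hX hY x hx
    exact h x (hVU hx) X Y ((hX.contMDiffAt (hV.mem_nhds hx)).mdifferentiableAt (by simp))
      ((hY.contMDiffAt (hV.mem_nhds hx)).mdifferentiableAt (by simp))

/-- The vanishing locus of the Nijenhuis tensor is closed. -/
lemma nijenhuisVanishesAt_of_dense (hJ : EndFieldContMDiffOn ∞ J Set.univ)
    (hsq : ∀ y v, J y (J y v) = ε • v) {U : Set M} (hU : Dense U)
    (h : ∀ x ∈ U, NijenhuisVanishesAt ε J x) (x : M) : NijenhuisVanishesAt ε J x := by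
  set φ := extChartAt 𝓘(ℝ, F) x with hφ
  have hxx : φ.symm (φ x) = x := extChartAt_to_inv x
  rw [← hxx, nijenhuisVanishesAt_iff_nijenhuisCoord hJ hsq (mem_extChartAt_target x)]
  intro v w
  by_contra hne
  have hcont := (continuousOn_nijenhuisCoord hJ x v w).continuousAt
    ((isOpen_extChartAt_target x).mem_nhds (mem_extChartAt_target x))
  have hev := (hcont.eventually_ne hne).and
    ((isOpen_extChartAt_target (I := 𝓘(ℝ, F)) x).mem_nhds (mem_extChartAt_target x))
  have hev' : ∀ᶠ y in 𝓝 x, nijenhuisCoord (endCoord x J) (φ y) v w ≠ 0 ∧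
      φ y ∈ φ.target ∧ y ∈ φ.source :=
    ((continuousAt_extChartAt x).eventually hev).and (extChartAt_source_mem_nhds x) |>.mono
      fun y hy => ⟨hy.1.1, hy.1.2, hy.2⟩
  obtain ⟨y, hyU, hy1, hy2, hy3⟩ := (hU.inter_nhds_nonempty hev')
  refine hy1 ((nijenhuisVanishesAt_iff_nijenhuisCoord hJ hsq hy2).1 ?_ v w)
  rw [φ.left_inv hy3]
  exact h y hyU

/-- Unique continuation: on a connected manifold with an analytic structure `J`, the Nijenhuis
tensor vanishes if it vanishes near one point. -/
lemma nijenhuisVanishesAt_of_analytic [ConnectedSpace M] [IsManifold 𝓘(ℝ, F) ω M]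
    (hJ : EndFieldContMDiffOn ∞ J Set.univ) (hJω : EndFieldContMDiffOn ω J Set.univ)
    (hsq : ∀ y v, J y (J y v) = ε • v) {x₀ : M}
    (h : ∀ᶠ x in 𝓝 x₀, NijenhuisVanishesAt ε J x) (x : M) : NijenhuisVanishesAt ε J x := by
  have : IsManifold 𝓘(ℝ, F) (ω + 1) M := ‹IsManifold 𝓘(ℝ, F) ω M›
  set S := {x | ∀ᶠ y in 𝓝 x, NijenhuisVanishesAt ε J y} with hS
  have hopen : IsOpen S := isOpen_setOfPred_eventually_nhds
  have hclosed : IsClosed S := by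
    rw [isClosed_iff_clusterPt]
    intro x hx
    set φ := extChartAt 𝓘(ℝ, F) x with hφ
    obtain ⟨r, hr, hball⟩ := Metric.mem_nhds_iff.1
      ((isOpen_extChartAt_target (I := 𝓘(ℝ, F)) x).mem_nhds (mem_extChartAt_target x))
    have hnear : ∀ᶠ y in 𝓝 x, φ y ∈ Metric.ball (φ x) r ∧ y ∈ φ.source :=
      Filter.Eventually.and ((continuousAt_extChartAt x).eventually (Metric.ball_mem_nhds _ hr))
        (extChartAt_source_mem_nhds x)
    obtain ⟨y, ⟨hy, hys⟩, hyS⟩ := (clusterPt_principal_iff.1 hx) _ hnear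
    have han (v w : F) : AnalyticOnNhd ℝ (fun u => nijenhuisCoord (endCoord x J) u v w)
        (Metric.ball (φ x) r) := by
      intro u hu
      have h0 : ContDiffAt ℝ ω (endCoord x J) u := contDiffAt_endCoord (hball hu) hJω
      have h1 : ContDiffAt ℝ ω (fderiv ℝ (endCoord x J)) u := h0.fderiv_right le_rfl
      have c {z : F → F} (hz : ContDiffAt ℝ ω z u) :
          ContDiffAt ℝ ω (fun u => endCoord x J u (z u)) u := h0.clm_apply hz
      have c' {z : F → F} (hz : ContDiffAt ℝ ω z u) (v : F) :
          ContDiffAt ℝ ω (fun u => fderiv ℝ (endCoord x J) u (z u) v) u :=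
        (h1.clm_apply hz).clm_apply contDiffAt_const
      exact ((((c' (c contDiffAt_const) w).sub (c' (c contDiffAt_const) v)).sub
        (c (c' contDiffAt_const w))).add (c (c' contDiffAt_const v))).analyticAt
    have hzero (v w : F) : Set.EqOn (fun u => nijenhuisCoord (endCoord x J) u v w) 0
        (Metric.ball (φ x) r) := by
      refine (han v w).eqOn_zero_of_preconnected_of_eventuallyEq_zero
        (convex_ball _ _).isPreconnected hy ?_
      have hyt : φ y ∈ φ.target := φ.map_source hys
      have hc : Filter.Tendsto φ.symm (𝓝 (φ y)) (𝓝 y) := by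
        have := (continuousOn_extChartAt_symm (I := 𝓘(ℝ, F)) x).continuousAt
          ((isOpen_extChartAt_target x).mem_nhds hyt)
        rwa [ContinuousAt, ← hφ, φ.left_inv hys] at this
      filter_upwards [hc.eventually hyS, (isOpen_extChartAt_target x).mem_nhds hyt] with u hu hut
      exact (nijenhuisVanishesAt_iff_nijenhuisCoord hJ hsq hut).1 hu v w
    filter_upwards [hnear] with z hz
    rw [← φ.left_inv hz.2, nijenhuisVanishesAt_iff_nijenhuisCoord hJ hsq (φ.map_source hz.2)]
    exact fun v w => hzero v w hz.1
  have huniv : S = Set.univ := IsClopen.eq_univ ⟨hclosed, hopen⟩ ⟨x₀, h⟩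
  have hx : x ∈ S := huniv ▸ Set.mem_univ x
  exact hx.self_of_nhds

end NijenhuisCoordinates

/-! ### Immersions and the induced structure -/

section Immersions

variable {F : Type*} [NormedAddCommGroup F] [NormedSpace ℝ F]
  {M : Type*} [TopologicalSpace M] [ChartedSpace F M]
  {E : Type*} [NormedAddCommGroup E] [NormedSpace ℝ E]
  {N : Type*} [TopologicalSpace N] [ChartedSpace E N]

/-- An immersion has a smooth left inverse locally. -/
lemma exists_local_leftInverse [IsManifold 𝓘(ℝ, F) ∞ M] [IsManifold 𝓘(ℝ, E) ∞ N] {f : M → N}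
    (hf : IsImmersion 𝓘(ℝ, F) 𝓘(ℝ, E) ∞ f) (x₀ : M) :
    ∃ (r : N → M) (V : Set N), IsOpen V ∧ f x₀ ∈ V ∧ ContMDiffOn 𝓘(ℝ, E) 𝓘(ℝ, F) ∞ r V ∧
      ∀ᶠ x in 𝓝 x₀, r (f x) = x := by
  obtain h : IsImmersionAt 𝓘(ℝ, F) 𝓘(ℝ, E) ∞ f x₀ := hf.isImmersionAt x₀
  set p : E → F := fun z => (h.equiv.symm z).1 with hp
  have hpc : ContDiff ℝ ∞ p := by
    exact (ContinuousLinearMap.fst ℝ F h.complement ∘L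
      (h.equiv.symm : E →L[ℝ] F × h.complement)).contDiff
  have key {x : M} (hx : x ∈ h.domChart.source) : p (h.codChart (f x)) = h.domChart x := by
    have := h.writtenInCharts (show h.domChart x ∈ (h.domChart.extend 𝓘(ℝ, F)).target by
      rw [OpenPartialHomeomorph.extend_target]
      simpa using h.domChart.map_source hx)
    simp only [Function.comp_apply, OpenPartialHomeomorph.extend_coe, modelWithCornersSelf_coe, id,
      OpenPartialHomeomorph.extend_coe_symm, modelWithCornersSelf_coe_symm,
      h.domChart.left_inv hx] at this
    rw [hp, this]
    simp
  refine ⟨fun z => h.domChart.symm (p (h.codChart z)),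
    h.codChart.source ∩ h.codChart ⁻¹' (p ⁻¹' h.domChart.target),
    h.codChart.isOpen_inter_preimage (h.domChart.open_target.preimage hpc.continuous),
    ⟨h.mem_codChart_source, ?_⟩, ?_, ?_⟩
  · rw [Set.mem_preimage, Set.mem_preimage, key h.mem_domChart_source]
    exact h.domChart.map_source h.mem_domChart_source
  · refine (contMDiffOn_symm_of_mem_maximalAtlas h.domChart_mem_maximalAtlas).comp
      (hpc.contMDiff.comp_contMDiffOn
        ((contMDiffOn_of_mem_maximalAtlas h.codChart_mem_maximalAtlas).mono
          Set.inter_subset_left)) ?_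
    exact fun z hz => hz.2
  · filter_upwards [h.domChart.open_source.mem_nhds h.mem_domChart_source] with x hx
    rw [key hx, h.domChart.left_inv hx]

/-- The local left inverse of an immersion gives a left inverse of the differential. -/
lemma eventually_mfderiv_leftInverse {f : M → N} (hf : ContMDiff 𝓘(ℝ, F) 𝓘(ℝ, E) ∞ f)
    {x₀ : M} {r : N → M} {V : Set N} (hV : IsOpen V) (hxV : f x₀ ∈ V)
    (hr : ContMDiffOn 𝓘(ℝ, E) 𝓘(ℝ, F) ∞ r V) (hrf : ∀ᶠ x in 𝓝 x₀, r (f x) = x) :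
    ∀ᶠ x in 𝓝 x₀, f x ∈ V ∧ r (f x) = x ∧ ∀ v : TangentSpace 𝓘(ℝ, F) x,
      mfderiv 𝓘(ℝ, E) 𝓘(ℝ, F) r (f x) (mfderiv 𝓘(ℝ, F) 𝓘(ℝ, E) f x v) = v := by
  filter_upwards [hrf.eventually_nhds, hf.continuous.continuousAt.eventually (hV.mem_nhds hxV)]
    with x hx hxV
  refine ⟨hxV, hx.self_of_nhds, fun v => ?_⟩
  have h1 : MDifferentiableAt 𝓘(ℝ, E) 𝓘(ℝ, F) r (f x) :=
    (hr.contMDiffAt (hV.mem_nhds hxV)).mdifferentiableAt (by simp)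
  have h2 : MDifferentiableAt 𝓘(ℝ, F) 𝓘(ℝ, E) f x := hf.mdifferentiable (by simp) x
  have h3 := (h1.hasMFDerivAt.comp x h2.hasMFDerivAt).congr_of_eventuallyEq (f₁ := id) (by
    filter_upwards [hx] with y hy using hy.symm)
  exact congr($(hasMFDerivAt_unique (hasMFDerivAt_id x) h3) v).symm

lemma mfderiv_injective_of_isImmersion [IsManifold 𝓘(ℝ, F) ∞ M] [IsManifold 𝓘(ℝ, E) ∞ N]
    {f : M → N} (hf : IsImmersion 𝓘(ℝ, F) 𝓘(ℝ, E) ∞ f) (x : M) :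
    Function.Injective (mfderiv 𝓘(ℝ, F) 𝓘(ℝ, E) f x) := by
  obtain ⟨r, V, hV, hxV, hr, hrf⟩ := exists_local_leftInverse hf x
  have h := (eventually_mfderiv_leftInverse hf.contMDiff hV hxV hr hrf).self_of_nhds.2.2
  intro v w hvw
  rw [← h v, ← h w, hvw]

variable [IsManifold 𝓘(ℝ, F) ∞ M] [IsManifold 𝓘(ℝ, E) ∞ N]

/-- A vector field on an immersed submanifold is locally related to one on the ambient manifold. -/
lemma exists_related_vectorField {f : M → N} (hf : IsImmersion 𝓘(ℝ, F) 𝓘(ℝ, E) ∞ f) {x₀ : M}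
    {X : Π y : M, TangentSpace 𝓘(ℝ, F) y} (hX : VectorFieldDiffAt X x₀) :
    ∃ X' : Π z : N, TangentSpace 𝓘(ℝ, E) z, VectorFieldDiffAt X' (f x₀) ∧
      ∀ᶠ y in 𝓝 x₀, X' (f y) = mfderiv 𝓘(ℝ, F) 𝓘(ℝ, E) f y (X y) := by
  have : IsManifold 𝓘(ℝ, F) (∞ + 1) M := ‹IsManifold 𝓘(ℝ, F) ∞ M›
  obtain ⟨r, V, hV, hxV, hr, hrf⟩ := exists_local_leftInverse hf x₀
  -- the coordinates of `df X`, as a function on `M`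
  set a : M → E := fun y => tangentCoord (f x₀) (f y) (mfderiv 𝓘(ℝ, F) 𝓘(ℝ, E) f y (X y)) with ha
  have hnear : ∀ᶠ y in 𝓝 x₀, f y ∈ (chartAt E (f x₀)).source :=
    hf.contMDiff.continuous.continuousAt.eventually
      ((chartAt E (f x₀)).open_source.mem_nhds (mem_chart_source E (f x₀)))
  have had : MDifferentiableAt 𝓘(ℝ, F) 𝓘(ℝ, E) a x₀ := by
    have h1 : ContMDiff 𝓘(ℝ, F).tangent 𝓘(ℝ, E).tangent ∞ (tangentMap 𝓘(ℝ, F) 𝓘(ℝ, E) f) :=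
      hf.contMDiff.contMDiff_tangentMap (by simp)
    have h2 := MDifferentiableAt.comp x₀
      (h1.mdifferentiable (by simp) (⟨x₀, X x₀⟩ : TangentBundle _ M)) hX
    have h3 := ((mdifferentiableAt_totalSpace _ _).1 h2).2
    refine h3.congr_of_eventuallyEq ?_
    filter_upwards [hnear] with y hy
    exact tangentCoord_apply hy _
  have hrx : r (f x₀) = x₀ := hrf.self_of_nhds
  have har : MDifferentiableAt 𝓘(ℝ, E) 𝓘(ℝ, E) (fun z => a (r z)) (f x₀) := by
    have h1 : MDifferentiableAt 𝓘(ℝ, E) 𝓘(ℝ, F) r (f x₀) :=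
      (hr.contMDiffAt (hV.mem_nhds hxV)).mdifferentiableAt (by simp)
    exact MDifferentiableAt.comp (f x₀) (by rwa [hrx]) h1
  refine ⟨fun z => tangentCoordSymm (f x₀) z (a (r z)), ?_, ?_⟩
  · refine (mdifferentiableAt_section _ _).2 ?_
    refine har.congr_of_eventuallyEq ?_
    filter_upwards [(chartAt E (f x₀)).open_source.mem_nhds (mem_chart_source E (f x₀))] with z hz
    exact (tangentCoord_apply hz _).symm.trans (tangentCoord_symm hz _)
  · filter_upwards [hrf, hnear] with y hy hy'
    rw [hy, ha, tangentCoordSymm_coord hy']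

end Immersions

namespace AlmostEpsHermitianSubmanifold

variable {E : Type*} [NormedAddCommGroup E] [NormedSpace ℝ E] [FiniteDimensional ℝ E]
  {N : Type*} [TopologicalSpace N] [ChartedSpace E N] [IsManifold 𝓘(ℝ, E) ∞ N]
  {F : Type*} [NormedAddCommGroup F] [NormedSpace ℝ F]
  {M : Type*} [TopologicalSpace M] [ChartedSpace F M] [IsManifold 𝓘(ℝ, F) ∞ M]
  {P : ParaQuaternionicKahlerStructure E N} {ε : ℝ}
  (S : AlmostEpsHermitianSubmanifold P ε F M)

/-- The differential of the immersion. -/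
abbrev df (x : M) : TangentSpace 𝓘(ℝ, F) x →L[ℝ] TangentSpace 𝓘(ℝ, E) (S.f x) :=
  mfderiv 𝓘(ℝ, F) 𝓘(ℝ, E) S.f x

lemma df_injective (x : M) : Function.Injective (S.df x) :=
  mfderiv_injective_of_isImmersion S.isImmersion x

lemma JT_JT (x : M) (v : TangentSpace 𝓘(ℝ, F) x) : S.JT x (S.JT x v) = ε • v := by
  apply S.df_injective x
  rw [df, S.JT_spec, S.JT_spec, map_smul]
  exact congr($(S.J_sq x) (S.df x v))

/-- The restriction `JT` is smooth: near any point it is `dr ∘ J ∘ df` for a local left inverse `r`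
of the immersion `f`. -/
lemma JT_smooth : EndFieldContMDiffOn ∞ S.JT Set.univ := by
  have : IsManifold 𝓘(ℝ, F) (∞ + 1) M := ‹IsManifold 𝓘(ℝ, F) ∞ M›
  have : IsManifold 𝓘(ℝ, E) (∞ + 1) N := ‹IsManifold 𝓘(ℝ, E) ∞ N›
  intro x₀ _
  refine ContMDiffAt.contMDiffWithinAt ?_
  have hf : ContMDiff 𝓘(ℝ, F) 𝓘(ℝ, E) ∞ S.f := S.isImmersion.contMDiff
  obtain ⟨r, V, hV, hxV, hr, hrf⟩ := exists_local_leftInverse S.isImmersion x₀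
  have hrx : r (S.f x₀) = x₀ := hrf.self_of_nhds
  rw [contMDiffAt_hom_bundle]
  refine ⟨contMDiffAt_id, ?_⟩
  have h1 := ContMDiffAt.mfderiv_const (m := ∞) (hf x₀) (by simp)
  have h2 := (contMDiffAt_hom_bundle _).1 (S.J_smooth x₀) |>.2
  have h3 := (ContMDiffAt.mfderiv_const (m := ∞) (hr.contMDiffAt (hV.mem_nhds hxV)) (by simp)).comp
    x₀ (hf x₀)
  refine (h3.clm_comp (h2.clm_comp h1)).congr_of_eventuallyEq ?_
  filter_upwards [eventually_mfderiv_leftInverse hf hV hxV hr hrf,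
    (chartAt F x₀).open_source.mem_nhds (mem_chart_source F x₀),
    hf.continuous.continuousAt.eventually
      ((chartAt E (S.f x₀)).open_source.mem_nhds (mem_chart_source E (S.f x₀)))] with y hy hyM hyN
  ext v
  have e1 : (tangentCoord x₀ y) (S.JT y (tangentCoordSymm x₀ y v)) =
      tangentCoord x₀ y (mfderiv 𝓘(ℝ, E) 𝓘(ℝ, F) r (S.f y)
        (tangentCoordSymm (S.f x₀) (S.f y) (tangentCoord (S.f x₀) (S.f y)
          (S.J y (tangentCoordSymm (S.f x₀) (S.f y) (tangentCoord (S.f x₀) (S.f y)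
            (S.df y (tangentCoordSymm x₀ y v)))))))) := by
    rw [tangentCoordSymm_coord hyN, tangentCoordSymm_coord hyN, df, ← S.JT_spec, hy.2.2]
  have e2 (w : F) : tangentCoord (F := F) x₀ y w = tangentCoord (F := F) x₀ (r (S.f y)) w := by
    rw [hy.2.1]
  refine (e1.trans (e2 _)).trans ?_
  simp only [inTangentCoordinates, Function.comp_apply, id, hrx]
  rfl

end AlmostEpsHermitianSubmanifold

/-! ### The Nijenhuis tensor in an adapted frame -/

namespace AlmostEpsHermitianSubmanifold

variable {E : Type*} [NormedAddCommGroup E] [NormedSpace ℝ E] [FiniteDimensional ℝ E]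
  {N : Type*} [TopologicalSpace N] [ChartedSpace E N] [IsManifold 𝓘(ℝ, E) ∞ N]
  {F : Type*} [NormedAddCommGroup F] [NormedSpace ℝ F]
  {M : Type*} [TopologicalSpace M] [ChartedSpace F M] [IsManifold 𝓘(ℝ, F) ∞ M]
  {P : ParaQuaternionicKahlerStructure E N} {ε : ℝ}
  {S : AlmostEpsHermitianSubmanifold P ε F M}

/-- The vector `ψ(X) Y + ε ψ(J X) J Y`, antisymmetrized in `X` and `Y`. The differential of
the immersion maps the Nijenhuis tensor to `-J₂` of this vector. -/
def AdaptedFrame.torsionVector (Φ : S.AdaptedFrame) (x : M) (X Y : TangentSpace 𝓘(ℝ, F) x) :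
    TangentSpace 𝓘(ℝ, F) x :=
  (Φ.psi x X • Y + (ε * Φ.psi x (S.JT x X)) • S.JT x Y)
    - (Φ.psi x Y • X + (ε * Φ.psi x (S.JT x Y)) • S.JT x X)

/-- The key formula. As the Levi-Civita connection `∇` has no torsion, the Nijenhuis tensor is
`(∇_{JX} J) Y - (∇_{JY} J) X + J (∇_Y J) X - J (∇_X J) Y`, and `∇ J₁ = -ω₃ ⊗ J₂ - ε ω₂ ⊗ J₃`. -/
lemma AdaptedFrame.df_nijenhuis [CompleteSpace F] (hε : ε = 1 ∨ ε = -1) (Φ : S.AdaptedFrame) {x : M}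
    (hx : x ∈ Φ.U) {X Y : Π y : M, TangentSpace 𝓘(ℝ, F) y} (hX : VectorFieldDiffAt X x)
    (hY : VectorFieldDiffAt Y x) :
    S.df x (nijenhuis ε S.JT X Y x) =
      -Φ.J₂ (S.f x) (S.df x (Φ.torsionVector x (X x) (Y x))) := by
  have : CompleteSpace E := FiniteDimensional.complete ℝ E
  have hf : ContMDiff 𝓘(ℝ, F) 𝓘(ℝ, E) ∞ S.f := S.isImmersion.contMDiff
  have hxV := Φ.mapsTo hx
  have hVn := Φ.isOpen_V.mem_nhds hxV
  obtain ⟨X', hX', hXX⟩ := exists_related_vectorField S.isImmersion hX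
  obtain ⟨Y', hY', hYY⟩ := exists_related_vectorField S.isImmersion hY
  have hJX := vectorFieldDiffAt_endField S.JT_smooth Filter.univ_mem hX
  have hJY := vectorFieldDiffAt_endField S.JT_smooth Filter.univ_mem hY
  have hJX' := vectorFieldDiffAt_endField Φ.isFrame.smooth₁ hVn hX'
  have hJY' := vectorFieldDiffAt_endField Φ.isFrame.smooth₁ hVn hY'
  have hrel {Z : Π y : M, TangentSpace 𝓘(ℝ, F) y} {Z' : Π z : N, TangentSpace 𝓘(ℝ, E) z}
      (h : ∀ᶠ y in 𝓝 x, Z' (S.f y) = S.df y (Z y)) :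
      ∀ᶠ y in 𝓝 x, Φ.J₁ (S.f y) (Z' (S.f y)) = S.df y (S.JT y (Z y)) := by
    filter_upwards [h, Φ.isOpen_U.mem_nhds hx] with y hy hyU
    rw [hy, Φ.adapted y hyU, df, S.JT_spec]
  have hJXX := hrel hXX
  have hJYY := hrel hYY
  have tors {A B : Π z : N, TangentSpace 𝓘(ℝ, E) z} (hA : VectorFieldDiffAt A (S.f x))
      (hB : VectorFieldDiffAt B (S.f x)) :=
    P.nabla.torsion_eq_zero_iff.1 P.isLeviCivita.torsion_eq_zero hA hB
  have b1 := (mfderiv_mlieBracket_of_related hf hJX hJY hJX' hJY' hJXX hJYY).trans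
    (tors hJX' hJY').symm
  have b2 := (mfderiv_mlieBracket_of_related hf hJX hY hJX' hY' hJXX hYY).trans
    (tors hJX' hY').symm
  have b3 := (mfderiv_mlieBracket_of_related hf hX hJY hX' hJY' hXX hJYY).trans
    (tors hX' hJY').symm
  have b4 := (mfderiv_mlieBracket_of_related hf hX hY hX' hY' hXX hYY).trans
    (tors hX' hY').symm
  have cX (v) := sub_eq_iff_eq_add.1 (Φ.isConnectionForms.cov₁ _ hxV v X' hX')
  have cY (v) := sub_eq_iff_eq_add.1 (Φ.isConnectionForms.cov₁ _ hxV v Y' hY')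
  have T := Φ.isFrame.triple _ hxV
  have q11 (v) : Φ.J₁ (S.f x) (Φ.J₁ (S.f x) v) = ε • v := congr($T.sq₁ v)
  have q12 (v) : Φ.J₁ (S.f x) (Φ.J₂ (S.f x) v) = Φ.J₃ (S.f x) v := congr($T.mul v).symm
  have q13 (v) : Φ.J₁ (S.f x) (Φ.J₃ (S.f x) v) = ε • Φ.J₂ (S.f x) v := by rw [← q12, q11]
  have q21 (v) : Φ.J₂ (S.f x) (Φ.J₁ (S.f x) v) = -Φ.J₃ (S.f x) v := by
    rw [← q12]
    exact (neg_eq_iff_eq_neg.2 congr($T.anti₁₂ v)).symm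
  have hxx := hXX.self_of_nhds
  have hyy := hYY.self_of_nhds
  have hJT (v) : S.df x (S.JT x v) = Φ.J₁ (S.f x) (S.df x v) := by
    rw [Φ.adapted x hx, df, S.JT_spec]
  have e : S.df x (nijenhuis ε S.JT X Y x) =
      S.df x (VectorField.mlieBracket 𝓘(ℝ, F) (fun y => S.JT y (X y)) (fun y => S.JT y (Y y)) x)
      - Φ.J₁ (S.f x) (S.df x (VectorField.mlieBracket 𝓘(ℝ, F) (fun y => S.JT y (X y)) Y x))
      - Φ.J₁ (S.f x) (S.df x (VectorField.mlieBracket 𝓘(ℝ, F) X (fun y => S.JT y (Y y)) x))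
      + ε • S.df x (VectorField.mlieBracket 𝓘(ℝ, F) X Y x) := by
    simp only [nijenhuis, map_sub, map_add, map_smul, hJT]
  have hψ (v) : Φ.psi x v = Φ.ω₃ (S.f x) (Φ.J₁ (S.f x) (S.df x v)) - Φ.ω₂ (S.f x) (S.df x v) := by
    rw [← hJT]
    rfl
  rw [e, df, b1, b2, b3, b4, cX, cX, cY, cY, hxx, hyy]
  simp only [AdaptedFrame.torsionVector, map_sub, map_add, map_smul, hJT, hψ, q11, q12, q13, q21,
    add_apply, smul_apply, smul_eq_mul]
  rcases hε with rfl | rfl <;> module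

end AlmostEpsHermitianSubmanifold

/-! ### Standard triples and their connection forms -/

lemma exists_functional_eq_one {E : Type*} [NormedAddCommGroup E] [NormedSpace ℝ E] {w : E}
    (hw : w ≠ 0) : ∃ ℓ : E →L[ℝ] ℝ, ℓ w = 1 :=
  SeparatingDual.exists_eq_one hw

section StandardTriples

variable {V : Type*} [AddCommGroup V] [Module ℝ V] [TopologicalSpace V]
    [IsTopologicalAddGroup V] [ContinuousConstSMul ℝ V] {ε₁ ε₂ ε₃ : ℝ} {J₁ J₂ J₃ : V →L[ℝ] V}

lemma IsStandardTriple.j₁₁ (T : IsStandardTriple ε₁ ε₂ ε₃ J₁ J₂ J₃) (v : V) :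
    J₁ (J₁ v) = ε₁ • v := congr($T.sq₁ v)

lemma IsStandardTriple.j₂₂ (T : IsStandardTriple ε₁ ε₂ ε₃ J₁ J₂ J₃) (v : V) :
    J₂ (J₂ v) = ε₂ • v := congr($T.sq₂ v)

lemma IsStandardTriple.j₃₃ (T : IsStandardTriple ε₁ ε₂ ε₃ J₁ J₂ J₃) (v : V) :
    J₃ (J₃ v) = ε₃ • v := congr($T.sq₃ v)

lemma IsStandardTriple.j₁₂ (T : IsStandardTriple ε₁ ε₂ ε₃ J₁ J₂ J₃) (v : V) :
    J₁ (J₂ v) = J₃ v := congr($T.mul v).symm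

lemma IsStandardTriple.j₂₁ (T : IsStandardTriple ε₁ ε₂ ε₃ J₁ J₂ J₃) (v : V) :
    J₂ (J₁ v) = -J₃ v := by
  rw [← T.j₁₂]
  exact (neg_eq_iff_eq_neg.2 congr($T.anti₁₂ v)).symm

lemma IsStandardTriple.j₁₃ (T : IsStandardTriple ε₁ ε₂ ε₃ J₁ J₂ J₃) (v : V) :
    J₁ (J₃ v) = ε₁ • J₂ v := by
  rw [← T.j₁₂, T.j₁₁]

lemma IsStandardTriple.j₃₁ (T : IsStandardTriple ε₁ ε₂ ε₃ J₁ J₂ J₃) (v : V) :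
    J₃ (J₁ v) = -(ε₁ • J₂ v) := by
  rw [← T.j₁₃]
  exact congr($T.anti₃₁ v)

lemma IsStandardTriple.j₃₂ (T : IsStandardTriple ε₁ ε₂ ε₃ J₁ J₂ J₃) (v : V) :
    J₃ (J₂ v) = ε₂ • J₁ v := by
  rw [← T.j₁₂, T.j₂₂, map_smul]

lemma IsStandardTriple.j₂₃ (T : IsStandardTriple ε₁ ε₂ ε₃ J₁ J₂ J₃) (v : V) :
    J₂ (J₃ v) = -(ε₂ • J₁ v) := by
  rw [← T.j₃₂]
  exact congr($T.anti₂₃ v)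

/-- Anticommutation recovers the first coefficient of a combination of a standard triple. -/
lemma IsStandardTriple.anticomm₁ (T : IsStandardTriple ε₁ ε₂ ε₃ J₁ J₂ J₃) (a b c : ℝ) (v : V) :
    (a • J₁ + b • J₂ + c • J₃) (J₁ v) + J₁ ((a • J₁ + b • J₂ + c • J₃) v) =
      (2 * (ε₁ * a)) • v := by
  simp only [add_apply, smul_apply, map_add, map_smul, T.j₁₁, T.j₂₁, T.j₃₁, T.j₁₂, T.j₁₃]
  module

lemma IsStandardTriple.anticomm₂ (T : IsStandardTriple ε₁ ε₂ ε₃ J₁ J₂ J₃) (a b c : ℝ) (v : V) :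
    (a • J₁ + b • J₂ + c • J₃) (J₂ v) + J₂ ((a • J₁ + b • J₂ + c • J₃) v) =
      (2 * (ε₂ * b)) • v := by
  simp only [add_apply, smul_apply, map_add, map_smul, T.j₂₂, T.j₂₁, T.j₁₂, T.j₃₂, T.j₂₃]
  module

lemma IsStandardTriple.anticomm₃ (T : IsStandardTriple ε₁ ε₂ ε₃ J₁ J₂ J₃) (a b c : ℝ) (v : V) :
    (a • J₁ + b • J₂ + c • J₃) (J₃ v) + J₃ ((a • J₁ + b • J₂ + c • J₃) v) =
      (2 * (ε₃ * c)) • v := by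
  simp only [add_apply, smul_apply, map_add, map_smul, T.j₃₃, T.j₃₁, T.j₁₃, T.j₃₂, T.j₂₃]
  module

lemma IsStandardTriple.linearIndependent [Nontrivial V] (T : IsStandardTriple ε₁ ε₂ ε₃ J₁ J₂ J₃)
    (h₁ : ε₁ ≠ 0) (h₂ : ε₂ ≠ 0) (h₃ : ε₃ ≠ 0) : LinearIndependent ℝ ![J₁, J₂, J₃] := by
  obtain ⟨v, hv⟩ := exists_ne (0 : V)
  rw [Fintype.linearIndependent_iff]
  intro g hg
  simp only [Fin.sum_univ_three, Matrix.cons_val_zero, Matrix.cons_val_one,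
    Matrix.cons_val] at hg
  have e1 := T.anticomm₁ (g 0) (g 1) (g 2) v
  have e2 := T.anticomm₂ (g 0) (g 1) (g 2) v
  have e3 := T.anticomm₃ (g 0) (g 1) (g 2) v
  rw [hg] at e1 e2 e3
  simp only [zero_apply, map_zero, add_zero] at e1 e2 e3
  intro i
  fin_cases i
  · simpa [h₁, hv] using e1.symm
  · simpa [h₂, hv] using e2.symm
  · simpa [h₃, hv] using e3.symm

/-- A second standard triple in the span of a first one spans the same subspace. -/
lemma IsStandardTriple.span_eq [Nontrivial V] (T : IsStandardTriple ε₁ ε₂ ε₃ J₁ J₂ J₃)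
    (h₁ : ε₁ ≠ 0) (h₂ : ε₂ ≠ 0) (h₃ : ε₃ ≠ 0) {I₁ I₂ I₃ : V →L[ℝ] V}
    (m₁ : J₁ ∈ Submodule.span ℝ {I₁, I₂, I₃}) (m₂ : J₂ ∈ Submodule.span ℝ {I₁, I₂, I₃})
    (m₃ : J₃ ∈ Submodule.span ℝ {I₁, I₂, I₃}) :
    Submodule.span ℝ {I₁, I₂, I₃} = Submodule.span ℝ {J₁, J₂, J₃} := by
  have hr (A B C : V →L[ℝ] V) : ({A, B, C} : Set (V →L[ℝ] V)) = Set.range ![A, B, C] := by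
    ext x
    simp only [Matrix.range_cons, Matrix.range_empty, Set.union_empty, Set.mem_insert_iff,
      Set.mem_singleton_iff, Set.mem_union]
  have : FiniteDimensional ℝ (Submodule.span ℝ {I₁, I₂, I₃}) :=
    FiniteDimensional.span_of_finite ℝ (by simp)
  refine (Submodule.eq_of_le_of_finrank_le ?_ ?_).symm
  · rw [Submodule.span_le]
    rintro _ (rfl | rfl | rfl) <;> assumption
  · rw [hr J₁, finrank_span_eq_card (T.linearIndependent h₁ h₂ h₃), hr I₁]
    exact finrank_range_le_card ![I₁, I₂, I₃]

/-- In the span of a standard triple with signs `(-1, 1, 1)`, elements of norm `ε` and `1` which are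
orthogonal for the quadratic form `-x ^ 2 + y ^ 2 + z ^ 2` form a standard triple with their
product. -/
lemma IsStandardTriple.of_orthonormal {I J K : V →L[ℝ] V}
    (T : IsStandardTriple (-1) 1 1 I J K) {ε a b c p q t : ℝ}
    (h₁ : -a ^ 2 + b ^ 2 + c ^ 2 = ε) (h₂ : -p ^ 2 + q ^ 2 + t ^ 2 = 1)
    (h₁₂ : -(a * p) + b * q + c * t = 0) :
    IsStandardTriple ε 1 (-ε) (a • I + b • J + c • K) (p • I + q • J + t • K)
      ((c * q - b * t) • I + (c * p - a * t) • J + (a * q - b * p) • K) := by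
  set A := a • I + b • J + c • K with hA
  set B := p • I + q • J + t • K with hB
  set C := (c * q - b * t) • I + (c * p - a * t) • J + (a * q - b * p) • K with hC
  have hAA (v : V) : A (A v) = ε • v := by
    simp only [hA, add_apply, smul_apply, map_add, map_smul, T.j₁₁, T.j₁₂, T.j₁₃, T.j₂₁, T.j₂₂,
      T.j₂₃, T.j₃₁, T.j₃₂, T.j₃₃, ← h₁]
    module
  have hBB (v : V) : B (B v) = v := by
    simp only [hB, add_apply, smul_apply, map_add, map_smul, T.j₁₁, T.j₁₂, T.j₁₃, T.j₂₁, T.j₂₂,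
      T.j₂₃, T.j₃₁, T.j₃₂, T.j₃₃]
    linear_combination (norm := module) h₂ • v
  have hAB (v : V) : A (B v) = C v := by
    rw [← add_zero (C v), ← zero_smul ℝ v, ← h₁₂]
    simp only [hA, hB, hC, add_apply, smul_apply, map_add, map_smul, T.j₁₁, T.j₁₂, T.j₁₃, T.j₂₁,
      T.j₂₂, T.j₂₃, T.j₃₁, T.j₃₂, T.j₃₃]
    module
  have hBA (v : V) : B (A v) = -C v := by
    rw [← add_zero (-C v), ← zero_smul ℝ v, ← h₁₂]
    simp only [hA, hB, hC, add_apply, smul_apply, map_add, map_smul, T.j₁₁, T.j₁₂, T.j₁₃, T.j₂₁,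
      T.j₂₂, T.j₂₃, T.j₃₁, T.j₃₂, T.j₃₃]
    module
  have hCA (v : V) : C (A v) = -A (C v) := by rw [← hAB, hBA, map_neg]
  have hBC (v : V) : B (C v) = -C (B v) := by rw [← hAB v, hBA]
  refine ⟨?_, ?_, ?_, ?_, ?_, ?_, ?_⟩ <;> ext v
  · exact hAA v
  · exact (hBB v).trans (one_smul ℝ v).symm
  · change C (C v) = (-ε) • v
    rw [← hAB, hBC, ← hAB, hBB, map_neg, hAA, neg_smul]
  · exact (hAB v).symm
  · exact (hAB v).trans ((congrArg Neg.neg (hBA v)).trans (neg_neg _)).symm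
  · exact hBC v
  · exact hCA v

end StandardTriples

section ConnectionForms

variable {E : Type*} [NormedAddCommGroup E] [NormedSpace ℝ E]
  {N : Type*} [TopologicalSpace N] [ChartedSpace E N] [IsManifold 𝓘(ℝ, E) ∞ N]
  {cov : CovariantDerivative 𝓘(ℝ, E) E (TangentSpace 𝓘(ℝ, E) : N → Type _)}
  {A A' : Π x : N, TangentSpace 𝓘(ℝ, E) x →L[ℝ] TangentSpace 𝓘(ℝ, E) x}
  {x : N} {v : TangentSpace 𝓘(ℝ, E) x} {B B' : TangentSpace 𝓘(ℝ, E) x →L[ℝ] TangentSpace 𝓘(ℝ, E) x}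

/-- The covariant derivative of a composition of endomorphism fields. The composition is given as a
field `C` which agrees with it near the point. -/
lemma HasCovDerivEnd.comp {C : Π x : N, TangentSpace 𝓘(ℝ, E) x →L[ℝ] TangentSpace 𝓘(ℝ, E) x}
    {V : Set N} (hV : V ∈ 𝓝 x) (hA : EndFieldContMDiffOn ∞ A V) (hA' : EndFieldContMDiffOn ∞ A' V)
    (h : HasCovDerivEnd cov A x v B) (h' : HasCovDerivEnd cov A' x v B')
    (hC : ∀ Y : Π x : N, TangentSpace 𝓘(ℝ, E) x, VectorFieldDiffAt Y x →
      VectorFieldDiffAt (fun y => C y (Y y)) x)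
    (hAC : ∀ y ∈ V, ∀ w, A y (A' y w) = C y w) :
    HasCovDerivEnd cov C x v (B ∘L A' x + A x ∘L B') := by
  intro Y hY
  have h1 := vectorFieldDiffAt_endField hA' hV hY
  have h2 := vectorFieldDiffAt_endField hA hV h1
  have e1 := cov.isCovariantDerivativeOn.congr_of_eqOn (hC Y hY) h2 hV
    fun y hy => (hAC y hy _).symm
  have e2 := h _ h1
  have e3 := sub_eq_iff_eq_add.1 (h' _ hY)
  rw [sub_eq_iff_eq_add] at e2
  rw [e1, e2, e3, ← hAC x (mem_of_mem_nhds hV), map_add, add_apply, ContinuousLinearMap.comp_apply,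
    ContinuousLinearMap.comp_apply]
  abel

/-- Differentiating `A ^ 2 = c`. -/
lemma HasCovDerivEnd.anticomm_of_sq {V : Set N} (hV : V ∈ 𝓝 x) (hA : EndFieldContMDiffOn ∞ A V)
    (h : HasCovDerivEnd cov A x v B) {c : ℝ} (hc : ∀ y ∈ V, ∀ w, A y (A y w) = c • w)
    (w : TangentSpace 𝓘(ℝ, E) x) : B (A x w) + A x (B w) = 0 := by
  obtain ⟨Y, hY, rfl⟩ := exists_vectorField_eq w
  have hsm {Z : Π x : N, TangentSpace 𝓘(ℝ, E) x} (hZ : VectorFieldDiffAt Z x) :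
      VectorFieldDiffAt (fun y => (c • ContinuousLinearMap.id ℝ (TangentSpace 𝓘(ℝ, E) y)) (Z y)) x :=
    mdifferentiableAt_const.smul_section hZ
  have h1 := h.comp (C := fun y => c • ContinuousLinearMap.id ℝ (TangentSpace 𝓘(ℝ, E) y)) hV hA hA h
    (fun Z hZ => hsm hZ) hc Y hY
  have h2 : cov (fun y => (c • ContinuousLinearMap.id ℝ (TangentSpace 𝓘(ℝ, E) y)) (Y y)) x =
      c • cov Y x := cov.isCovariantDerivativeOn.smul_const (s := Set.univ) c hY
  rw [h2] at h1
  simpa using h1.symm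

/-- For fixed `w`, the vector `(∇_v A) w` depends linearly on `v`. -/
lemma exists_covDerivEnd_apply_eq (cov : CovariantDerivative 𝓘(ℝ, E) E
    (TangentSpace 𝓘(ℝ, E) : N → Type _))
    (A : Π x : N, TangentSpace 𝓘(ℝ, E) x →L[ℝ] TangentSpace 𝓘(ℝ, E) x)
    {x : N} (w : TangentSpace 𝓘(ℝ, E) x) :
    ∃ L : TangentSpace 𝓘(ℝ, E) x →L[ℝ] TangentSpace 𝓘(ℝ, E) x,
      ∀ v B, HasCovDerivEnd cov A x v B → B w = L v := by
  obtain ⟨Y, hY, rfl⟩ := exists_vectorField_eq w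
  exact ⟨cov (fun y => A y (Y y)) x - A x ∘L cov Y x, fun v B h => (h Y hY).symm⟩

end ConnectionForms

namespace ParaQuaternionicKahlerStructure

variable {E : Type*} [NormedAddCommGroup E] [NormedSpace ℝ E] [FiniteDimensional ℝ E] [Nontrivial E]
  {N : Type*} [TopologicalSpace N] [ChartedSpace E N] [IsManifold 𝓘(ℝ, E) ∞ N]
  (P : ParaQuaternionicKahlerStructure E N)

/-- A standard frame with signs `(ε, 1, -ε)` has connection forms: the relations of the frame make
the matrix of `∇` skew, and its entries are read off by anticommutation. -/
lemma exists_isConnectionForms {ε : ℝ} (hε : ε = 1 ∨ ε = -1)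
    {J₁ J₂ J₃ : Π x : N, TangentSpace 𝓘(ℝ, E) x →L[ℝ] TangentSpace 𝓘(ℝ, E) x} {V : Set N}
    (hV : IsOpen V) (h : IsStandardFrameOn P.Q ε 1 (-ε) J₁ J₂ J₃ V) :
    ∃ ω₁ ω₂ ω₃ : Π x : N, TangentSpace 𝓘(ℝ, E) x →L[ℝ] ℝ,
      IsConnectionForms P.nabla ε 1 (-ε) J₁ J₂ J₃ ω₁ ω₂ ω₃ V := by
  have hεε : ε * ε = 1 := by rcases hε with rfl | rfl <;> norm_num
  have hε0 : ε ≠ 0 := by rcases hε with rfl | rfl <;> norm_num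
  have key (x : N) : ∃ η : Fin 3 → (TangentSpace 𝓘(ℝ, E) x →L[ℝ] ℝ), x ∈ V → ∀ v,
      HasCovDerivEnd P.nabla J₁ x v (-(1 * η 2 v) • J₂ x + (-ε * η 1 v) • J₃ x) ∧
      HasCovDerivEnd P.nabla J₂ x v (-(-ε * η 0 v) • J₃ x + (ε * η 2 v) • J₁ x) ∧
      HasCovDerivEnd P.nabla J₃ x v (-(ε * η 1 v) • J₁ x + (1 * η 0 v) • J₂ x) := by
    by_cases hx : x ∈ V
    swap
    · exact ⟨0, fun h => absurd h hx⟩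
    have hVx := hV.mem_nhds hx
    have T := h.triple x hx
    have coeffs {A : Π x : N, TangentSpace 𝓘(ℝ, E) x →L[ℝ] TangentSpace 𝓘(ℝ, E) x}
        (hA : EndFieldContMDiffOn ∞ A V) (hAQ : ∀ y ∈ V, A y ∈ Submodule.span ℝ {J₁ y, J₂ y, J₃ y})
        (v : TangentSpace 𝓘(ℝ, E) x) : ∃ a b c : ℝ,
          HasCovDerivEnd P.nabla A x v (a • J₁ x + b • J₂ x + c • J₃ x) := by
      obtain ⟨B, hB, hBc⟩ := P.parallel V A hV hA (fun y hy => by rw [h.span y hy]; exact hAQ y hy)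
        x hx v
      rw [h.span x hx, Submodule.mem_span_triple] at hB
      obtain ⟨a, b, c, rfl⟩ := hB
      exact ⟨a, b, c, hBc⟩
    choose p₁ p₂ p₃ hp using coeffs h.smooth₁ fun y _ => Submodule.subset_span (by simp)
    choose q₁ q₂ q₃ hq using coeffs h.smooth₂ fun y _ => Submodule.subset_span (by simp)
    have hr (v) := (hp v).comp hVx h.smooth₁ h.smooth₂ (hq v)
      (fun Y hY => vectorFieldDiffAt_endField h.smooth₃ hVx hY) fun y hy => (h.triple y hy).j₁₂
    have hne : Nontrivial (TangentSpace 𝓘(ℝ, E) x) := ‹Nontrivial E›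
    obtain ⟨w, hw⟩ := exists_ne (0 : TangentSpace 𝓘(ℝ, E) x)
    have hp₁ (v) : p₁ v = 0 := by
      have := (hp v).anticomm_of_sq hVx h.smooth₁ (fun y hy => (h.triple y hy).j₁₁) w
      rw [T.anticomm₁] at this
      simpa [hw, hε0] using this
    have hq₂ (v) : q₂ v = 0 := by
      have := (hq v).anticomm_of_sq hVx h.smooth₂ (fun y hy => (h.triple y hy).j₂₂) w
      rw [T.anticomm₂] at this
      simpa [hw] using this
    have hr' (v) : (p₁ v • J₁ x + p₂ v • J₂ x + p₃ v • J₃ x) ∘L J₂ x +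
        J₁ x ∘L (q₁ v • J₁ x + q₂ v • J₂ x + q₃ v • J₃ x) =
        (p₂ v + ε * q₁ v) • ContinuousLinearMap.id ℝ _ + p₃ v • J₁ x + (ε * q₃ v) • J₂ x := by
      ext w
      simp only [add_apply, smul_apply, ContinuousLinearMap.comp_apply, map_add, map_smul, hp₁, hq₂,
        T.j₁₁, T.j₂₂, T.j₁₃, T.j₃₂, ContinuousLinearMap.id_apply]
      module
    have hpq (v) : p₂ v = -(ε * q₁ v) := by
      have := (hr v).anticomm_of_sq hVx h.smooth₃ (fun y hy => (h.triple y hy).j₃₃) (J₃ x w)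
      rw [hr'] at this
      simp only [add_apply, smul_apply, map_add, map_smul, map_neg, T.j₃₃, T.j₃₁,
        T.j₁₃, T.j₂₃, T.j₃₂, ContinuousLinearMap.id_apply] at this
      have h2 : (-2 * ε * (p₂ v + ε * q₁ v)) • w = 0 := by
        rw [← this]
        module
      have h3 : -2 * ε * (p₂ v + ε * q₁ v) = 0 := (smul_eq_zero.1 h2).resolve_right hw
      have h4 : p₂ v + ε * q₁ v = 0 :=
        (mul_eq_zero.1 h3).resolve_left (mul_ne_zero (by norm_num) hε0)
      linarith
    obtain ⟨ℓ, hℓ⟩ : ∃ ℓ : TangentSpace 𝓘(ℝ, E) x →L[ℝ] ℝ, ℓ w = 1 :=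
      exists_functional_eq_one (E := E) hw
    -- the coefficients depend linearly on `v`
    have lin {A : Π x : N, TangentSpace 𝓘(ℝ, E) x →L[ℝ] TangentSpace 𝓘(ℝ, E) x}
        {K : TangentSpace 𝓘(ℝ, E) x →L[ℝ] TangentSpace 𝓘(ℝ, E) x}
        {B : TangentSpace 𝓘(ℝ, E) x → TangentSpace 𝓘(ℝ, E) x →L[ℝ] TangentSpace 𝓘(ℝ, E) x}
        {s : ℝ} (hs : s ≠ 0) {c : TangentSpace 𝓘(ℝ, E) x → ℝ}
        (hB : ∀ v, HasCovDerivEnd P.nabla A x v (B v))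
        (hc : ∀ v, B v (K w) + K (B v w) = (2 * (s * c v)) • w) :
        ∃ L : TangentSpace 𝓘(ℝ, E) x →L[ℝ] ℝ, ∀ v, c v = L v := by
      obtain ⟨L₁, hL₁⟩ := exists_covDerivEnd_apply_eq P.nabla A (K w)
      obtain ⟨L₂, hL₂⟩ := exists_covDerivEnd_apply_eq P.nabla A w
      refine ⟨(2 * s)⁻¹ • (ℓ ∘L (L₁ + K ∘L L₂)), fun v => ?_⟩
      have := congrArg ℓ (hc v)
      rw [hL₁ v _ (hB v), hL₂ v _ (hB v), map_smul, hℓ] at this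
      simp only [smul_apply, ContinuousLinearMap.comp_apply, add_apply, this, smul_eq_mul]
      field_simp
    obtain ⟨L₃, hL₃⟩ := lin one_ne_zero hp fun v => T.anticomm₂ (p₁ v) (p₂ v) (p₃ v) w
    obtain ⟨L₂, hL₂⟩ := lin (neg_ne_zero.2 hε0) hp fun v => T.anticomm₃ (p₁ v) (p₂ v) (p₃ v) w
    obtain ⟨L₁, hL₁⟩ := lin (neg_ne_zero.2 hε0) hq fun v => T.anticomm₃ (q₁ v) (q₂ v) (q₃ v) w
    refine ⟨![ε • L₁, -ε • L₂, -L₃], fun _ v => ⟨?_, ?_, ?_⟩⟩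
    · convert hp v using 1
      simp only [Matrix.cons_val, smul_apply, neg_apply, ← hL₂, ← hL₃, hp₁, smul_eq_mul]
      linear_combination (norm := module) (p₃ v * hεε) • J₃ x
    · convert hq v using 1
      simp only [Matrix.cons_val, Matrix.cons_val_zero, smul_apply, neg_apply, ← hL₁, ← hL₃, hq₂,
        smul_eq_mul, hpq]
      linear_combination (norm := module) (q₃ v * hεε) • J₃ x + (q₁ v * hεε) • J₁ x
    · convert hr v using 1
      rw [hr']
      simp only [Matrix.cons_val, Matrix.cons_val_zero, smul_apply, ← hL₁, ← hL₂, hpq,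
        smul_eq_mul]
      linear_combination (norm := module) (p₃ v * hεε) • J₁ x
  choose η hη using key
  exact ⟨fun x => η x 0, fun x => η x 1, fun x => η x 2, fun x hx v => (hη x hx v).1,
    fun x hx v => (hη x hx v).2.1, fun x hx v => (hη x hx v).2.2⟩

end ParaQuaternionicKahlerStructure

/-! ### Existence of adapted frames -/

section Combinations

variable {E : Type*} [NormedAddCommGroup E] [NormedSpace ℝ E]
  {N : Type*} [TopologicalSpace N] [ChartedSpace E N] {V : Set N} {a b c : N → ℝ}

lemma EndFieldContMDiffOn.combination [IsManifold 𝓘(ℝ, E) ∞ N]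
    {I J K : Π x : N, TangentSpace 𝓘(ℝ, E) x →L[ℝ] TangentSpace 𝓘(ℝ, E) x}
    (hI : EndFieldContMDiffOn ∞ I V) (hJ : EndFieldContMDiffOn ∞ J V)
    (hK : EndFieldContMDiffOn ∞ K V) (ha : ContMDiffOn 𝓘(ℝ, E) 𝓘(ℝ, ℝ) ∞ a V)
    (hb : ContMDiffOn 𝓘(ℝ, E) 𝓘(ℝ, ℝ) ∞ b V) (hc : ContMDiffOn 𝓘(ℝ, E) 𝓘(ℝ, ℝ) ∞ c V) :
    EndFieldContMDiffOn ∞ (fun x => a x • I x + b x • J x + c x • K x) V := by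
  have : IsManifold 𝓘(ℝ, E) (∞ + 1) N := ‹IsManifold 𝓘(ℝ, E) ∞ N›
  exact ((ha.smul_section hI).add_section (hb.smul_section hJ)).add_section (hc.smul_section hK)

/-- For the form `-x ^ 2 + y ^ 2 + z ^ 2` on `ℝ³`, a smooth map with values of norm `ε` has a smooth
orthogonal map with values of norm `1`. -/
lemma exists_smooth_orthonormal {ε : ℝ} (hε : ε = 1 ∨ ε = -1)
    (ha : ContMDiffOn 𝓘(ℝ, E) 𝓘(ℝ, ℝ) ∞ a V) (hb : ContMDiffOn 𝓘(ℝ, E) 𝓘(ℝ, ℝ) ∞ b V)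
    (hc : ContMDiffOn 𝓘(ℝ, E) 𝓘(ℝ, ℝ) ∞ c V)
    (h : ∀ x ∈ V, -a x ^ 2 + b x ^ 2 + c x ^ 2 = ε) :
    ∃ p q t : N → ℝ, ContMDiffOn 𝓘(ℝ, E) 𝓘(ℝ, ℝ) ∞ p V ∧ ContMDiffOn 𝓘(ℝ, E) 𝓘(ℝ, ℝ) ∞ q V ∧
      ContMDiffOn 𝓘(ℝ, E) 𝓘(ℝ, ℝ) ∞ t V ∧ (∀ x ∈ V, -p x ^ 2 + q x ^ 2 + t x ^ 2 = 1) ∧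
      ∀ x ∈ V, -(a x * p x) + b x * q x + c x * t x = 0 := by
  have hinv {u : N → ℝ} (hu : ContMDiffOn 𝓘(ℝ, E) 𝓘(ℝ, ℝ) ∞ u V) (hpos : ∀ x ∈ V, 0 < u x) :
      ContMDiffOn 𝓘(ℝ, E) 𝓘(ℝ, ℝ) ∞ (fun x => (√(u x))⁻¹) V := fun x hx =>
    ((Real.contDiffAt_sqrt (hpos x hx).ne').inv
      (Real.sqrt_pos.2 (hpos x hx)).ne').contMDiffAt.comp_contMDiffWithinAt x (hu x hx)
  have hsq {s : ℝ} (hs : 0 < s) : (√s)⁻¹ ^ 2 * s = 1 := by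
    rw [inv_pow, Real.sq_sqrt hs.le, inv_mul_cancel₀ hs.ne']
  -- the normalized vectors `(0, c, -b)` for `ε = 1` and `(b, a, 0)` for `ε = -1`
  rcases hε with rfl | rfl
  · have hpos (x) (hx : x ∈ V) : 0 < b x * b x + c x * c x := by nlinarith [h x hx, sq_nonneg (a x)]
    have hi := hinv ((hb.mul hb).add (hc.mul hc)) hpos
    refine ⟨fun _ => 0, fun x => (√(b x * b x + c x * c x))⁻¹ * c x,
      fun x => -(√(b x * b x + c x * c x))⁻¹ * b x, contMDiffOn_const, hi.mul hc,
      hi.neg.mul hb, fun x hx => ?_, fun x _ => ?_⟩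
    · linear_combination hsq (hpos x hx)
    · ring
  · have hpos (x) (hx : x ∈ V) : 0 < a x * a x - b x * b x := by
      nlinarith [h x hx, sq_nonneg (c x)]
    have hi := hinv ((ha.mul ha).sub (hb.mul hb)) hpos
    refine ⟨fun x => (√(a x * a x - b x * b x))⁻¹ * b x, fun x => (√(a x * a x - b x * b x))⁻¹ * a x,
      fun _ => 0, hi.mul hb, hi.mul ha, contMDiffOn_const, fun x hx => ?_, fun x _ => ?_⟩
    · linear_combination hsq (hpos x hx)
    · ring

end Combinations

namespace AlmostEpsHermitianSubmanifold

variable {E : Type*} [NormedAddCommGroup E] [NormedSpace ℝ E] [FiniteDimensional ℝ E]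
  {N : Type*} [TopologicalSpace N] [ChartedSpace E N] [IsManifold 𝓘(ℝ, E) ∞ N]
  {F : Type*} [NormedAddCommGroup F] [NormedSpace ℝ F]
  {M : Type*} [TopologicalSpace M] [ChartedSpace F M] [IsManifold 𝓘(ℝ, F) ∞ M]
  {P : ParaQuaternionicKahlerStructure E N} {ε : ℝ}
  (S : AlmostEpsHermitianSubmanifold P ε F M)

/-- The anticommutator of `J` with a smooth endomorphism field, evaluated in coordinates, is a
smooth function on the submanifold. -/
lemma contMDiffOn_anticommutator {V : Set N}
    {A : Π z : N, TangentSpace 𝓘(ℝ, E) z →L[ℝ] TangentSpace 𝓘(ℝ, E) z}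
    (hA : EndFieldContMDiffOn ∞ A V) (z₀ : N) (w : E) (ℓ : E →L[ℝ] ℝ) :
    ContMDiffOn 𝓘(ℝ, F) 𝓘(ℝ, ℝ) ∞ (fun y => ℓ (tangentCoord z₀ (S.f y)
      (S.J y (A (S.f y) (tangentCoordSymm z₀ (S.f y) w))
        + A (S.f y) (S.J y (tangentCoordSymm z₀ (S.f y) w)))))
      (S.f ⁻¹' (V ∩ (chartAt E z₀).source)) := by
  have : IsManifold 𝓘(ℝ, E) (∞ + 1) N := ‹IsManifold 𝓘(ℝ, E) ∞ N›
  have hf : ContMDiffOn 𝓘(ℝ, F) 𝓘(ℝ, E) ∞ S.f (S.f ⁻¹' (V ∩ (chartAt E z₀).source)) :=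
    S.isImmersion.contMDiff.contMDiffOn
  have h1 := (vectorFieldSmoothOn_constField z₀ w).comp hf fun y hy => hy.2
  have h2 := hA.comp hf fun y hy => hy.1
  have h3 := S.J_smooth.contMDiffOn (s := S.f ⁻¹' (V ∩ (chartAt E z₀).source))
  have h4 := h3.clm_bundle_apply (h2.clm_bundle_apply h1)
  have h5 := h2.clm_bundle_apply (h3.clm_bundle_apply h1)
  have hcoord {X : Π y : M, TangentSpace 𝓘(ℝ, E) (S.f y)}
      (hX : ContMDiffOn 𝓘(ℝ, F) (𝓘(ℝ, E).prod 𝓘(ℝ, E)) ∞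
        (fun y => TotalSpace.mk' E (E := (TangentSpace 𝓘(ℝ, E) : N → Type _)) (S.f y) (X y))
        (S.f ⁻¹' (V ∩ (chartAt E z₀).source))) :
      ContMDiffOn 𝓘(ℝ, F) 𝓘(ℝ, E) ∞ (fun y => tangentCoord z₀ (S.f y) (X y))
        (S.f ⁻¹' (V ∩ (chartAt E z₀).source)) := by
    have := (((trivializationAt E (TangentSpace 𝓘(ℝ, E) : N → Type _) z₀).contMDiffOn_iff
      (fun y hy => by
        rw [Trivialization.mem_source]
        exact mem_baseSet_of_mem_source hy.2)).1 hX).2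
    exact this.congr fun y hy => tangentCoord_apply hy.2 _
  refine (ℓ.contMDiff.comp_contMDiffOn ((hcoord h4).add (hcoord h5))).congr fun y _ => ?_
  rw [map_add (tangentCoord z₀ (S.f y))]
  rfl

/-- Near a point, `J` is a combination of any standard frame with smooth coefficients. -/
lemma exists_smooth_coefficients [Nontrivial E] {V : Set N}
    {I₁ I₂ I₃ : Π z : N, TangentSpace 𝓘(ℝ, E) z →L[ℝ] TangentSpace 𝓘(ℝ, E) z}
    (h : IsStandardFrameOn P.Q (-1) 1 1 I₁ I₂ I₃ V) (z₀ : N) :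
    ∃ a b c : M → ℝ, ContMDiffOn 𝓘(ℝ, F) 𝓘(ℝ, ℝ) ∞ a (S.f ⁻¹' (V ∩ (chartAt E z₀).source)) ∧
      ContMDiffOn 𝓘(ℝ, F) 𝓘(ℝ, ℝ) ∞ b (S.f ⁻¹' (V ∩ (chartAt E z₀).source)) ∧
      ContMDiffOn 𝓘(ℝ, F) 𝓘(ℝ, ℝ) ∞ c (S.f ⁻¹' (V ∩ (chartAt E z₀).source)) ∧
      ∀ y ∈ S.f ⁻¹' (V ∩ (chartAt E z₀).source),
        S.J y = a y • I₁ (S.f y) + b y • I₂ (S.f y) + c y • I₃ (S.f y) := by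
  obtain ⟨w, hw⟩ := exists_ne (0 : E)
  obtain ⟨ℓ, hℓ⟩ := exists_functional_eq_one hw
  have k₁ := S.contMDiffOn_anticommutator h.smooth₁ z₀ w ((-1 / 2 : ℝ) • ℓ)
  have k₂ := S.contMDiffOn_anticommutator h.smooth₂ z₀ w ((1 / 2 : ℝ) • ℓ)
  have k₃ := S.contMDiffOn_anticommutator h.smooth₃ z₀ w ((1 / 2 : ℝ) • ℓ)
  refine ⟨_, _, _, k₁, k₂, k₃.mono fun y hy => hy, fun y hy => ?_⟩
  have hJ := S.J_mem y
  rw [h.span _ hy.1, Submodule.mem_span_triple] at hJ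
  obtain ⟨a, b, c, hJ⟩ := hJ
  have T := h.triple _ hy.1
  rw [← hJ]
  simp only [T.anticomm₁, T.anticomm₂, T.anticomm₃, map_smul, tangentCoord_symm hy.2, smul_apply, hℓ,
    smul_eq_mul]
  module

/-- Every point of the submanifold lies in the domain of an adapted frame: extend `J` to the ambient
manifold along a local left inverse of the immersion, and complete it to a standard triple. -/
lemma exists_adaptedFrame [Nontrivial E] (hε : ε = 1 ∨ ε = -1) (x₀ : M) :
    ∃ Φ : S.AdaptedFrame, x₀ ∈ Φ.U := by
  have hε0 : ε ≠ 0 := by rcases hε with rfl | rfl <;> norm_num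
  have hf : ContMDiff 𝓘(ℝ, F) 𝓘(ℝ, E) ∞ S.f := S.isImmersion.contMDiff
  obtain ⟨V₀, hV₀, hxV₀, I₁, I₂, I₃, h⟩ := P.locally_standard (S.f x₀)
  obtain ⟨a, b, c, ha, hb, hc, habc⟩ := S.exists_smooth_coefficients h (S.f x₀)
  obtain ⟨r, V, hV, hxV, hr, hrf⟩ := exists_local_leftInverse S.isImmersion x₀
  set U₀ : Set M := S.f ⁻¹' (V₀ ∩ (chartAt E (S.f x₀)).source) with hU₀
  have hU₀o : IsOpen U₀ := (hV₀.inter (chartAt E (S.f x₀)).open_source).preimage hf.continuous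
  have hxU₀ : x₀ ∈ U₀ := ⟨hxV₀, mem_chart_source E (S.f x₀)⟩
  obtain ⟨U₁, hU₁r, hU₁o, hxU₁⟩ := eventually_nhds_iff.1 hrf
  -- the relation satisfied by the coefficients, because `J ^ 2 = ε`
  have hrel (y) (hy : y ∈ U₀) : -a y ^ 2 + b y ^ 2 + c y ^ 2 = ε := by
    have T := h.triple _ hy.1
    obtain ⟨w, hw⟩ : ∃ w : TangentSpace 𝓘(ℝ, E) (S.f y), w ≠ 0 := exists_ne (0 : E)
    have e := congr($(S.J_sq y) w)
    simp only [habc y hy, ContinuousLinearMap.comp_apply, add_apply, smul_apply, map_add, map_smul,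
      T.j₁₁, T.j₁₂, T.j₁₃, T.j₂₁, T.j₂₂, T.j₂₃, T.j₃₁, T.j₃₂, T.j₃₃,
      ContinuousLinearMap.id_apply] at e
    have e' : (-a y ^ 2 + b y ^ 2 + c y ^ 2 - ε) • w = 0 := by
      rw [sub_smul, ← e]
      module
    linarith [(smul_eq_zero.1 e').resolve_right hw]
  set V₁ : Set N := V ∩ r ⁻¹' U₀ ∩ V₀ with hV₁
  have hV₁o : IsOpen V₁ := (hr.continuousOn.isOpen_inter_preimage hV hU₀o).inter hV₀
  have hrV₁ : ContMDiffOn 𝓘(ℝ, E) 𝓘(ℝ, F) ∞ r V₁ := hr.mono fun z hz => hz.1.1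
  have hrU₀ : Set.MapsTo r V₁ U₀ := fun z hz => hz.1.2
  have hα := ha.comp hrV₁ hrU₀
  have hβ := hb.comp hrV₁ hrU₀
  have hγ := hc.comp hrV₁ hrU₀
  obtain ⟨p, q, t, hp, hq, ht, hpqt, horth⟩ := exists_smooth_orthonormal hε hα hβ hγ
    fun z hz => hrel (r z) (hrU₀ hz)
  have hVV : V₁ ⊆ V₀ := fun z hz => hz.2
  have s₁ : EndFieldContMDiffOn ∞ I₁ V₁ := h.smooth₁.mono hVV
  have s₂ : EndFieldContMDiffOn ∞ I₂ V₁ := h.smooth₂.mono hVV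
  have s₃ : EndFieldContMDiffOn ∞ I₃ V₁ := h.smooth₃.mono hVV
  have triple (z) (hz : z ∈ V₁) := (h.triple z (hVV hz)).of_orthonormal (hrel (r z) (hrU₀ hz))
    (hpqt z hz) (horth z hz)
  have mem_span (z : N) (a b c : ℝ) :
      a • I₁ z + b • I₂ z + c • I₃ z ∈ Submodule.span ℝ {I₁ z, I₂ z, I₃ z} :=
    Submodule.mem_span_triple.2 ⟨a, b, c, rfl⟩
  have frame : IsStandardFrameOn P.Q ε 1 (-ε)
      (fun z => a (r z) • I₁ z + b (r z) • I₂ z + c (r z) • I₃ z)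
      (fun z => p z • I₁ z + q z • I₂ z + t z • I₃ z)
      (fun z => (c (r z) * q z - b (r z) * t z) • I₁ z + (c (r z) * p z - a (r z) * t z) • I₂ z
        + (a (r z) * q z - b (r z) * p z) • I₃ z) V₁ := by
    refine ⟨s₁.combination s₂ s₃ hα hβ hγ, s₁.combination s₂ s₃ hp hq ht,
      s₁.combination s₂ s₃ ((hγ.mul hq).sub (hβ.mul ht)) ((hγ.mul hp).sub (hα.mul ht))
        ((hα.mul hq).sub (hβ.mul hp)), triple, fun z hz => ?_⟩
    have : Nontrivial (TangentSpace 𝓘(ℝ, E) z) := ‹Nontrivial E›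
    rw [h.span z (hVV hz)]
    exact (triple z hz).span_eq hε0 one_ne_zero (neg_ne_zero.2 hε0) (mem_span _ _ _ _)
      (mem_span _ _ _ _) (mem_span _ _ _ _)
  obtain ⟨η₁, η₂, η₃, hη⟩ := P.exists_isConnectionForms hε hV₁o frame
  have hxV₁ : S.f x₀ ∈ V₁ := ⟨⟨hxV, by rwa [Set.mem_preimage, hU₁r x₀ hxU₁]⟩, hxV₀⟩
  refine ⟨{ U := U₁ ∩ S.f ⁻¹' V₁
            V := V₁
            isOpen_U := hU₁o.inter (hV₁o.preimage hf.continuous)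
            isOpen_V := hV₁o
            mapsTo := fun y hy => hy.2
            J₁ := _
            J₂ := _
            J₃ := _
            isFrame := frame
            adapted := fun y hy => ?_
            ω₁ := η₁
            ω₂ := η₂
            ω₃ := η₃
            isConnectionForms := hη }, hxU₁, hxV₁⟩
  have hyU₀ : y ∈ U₀ := by
    have := hrU₀ hy.2
    rwa [hU₁r y hy.1] at this
  simp only [hU₁r y hy.1, habc y hyU₀]

end AlmostEpsHermitianSubmanifold

/-! ### The invariant part of the tangent space -/

namespace AlmostEpsHermitianSubmanifold

variable {E : Type*} [NormedAddCommGroup E] [NormedSpace ℝ E] [FiniteDimensional ℝ E]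
  {N : Type*} [TopologicalSpace N] [ChartedSpace E N] [IsManifold 𝓘(ℝ, E) ∞ N]
  {F : Type*} [NormedAddCommGroup F] [NormedSpace ℝ F]
  {M : Type*} [TopologicalSpace M] [ChartedSpace F M] [IsManifold 𝓘(ℝ, F) ∞ M]
  {P : ParaQuaternionicKahlerStructure E N} {ε : ℝ}
  {S : AlmostEpsHermitianSubmanifold P ε F M}

lemma AdaptedFrame.df_JT (Φ : S.AdaptedFrame) {x : M} (hx : x ∈ Φ.U)
    (v : TangentSpace 𝓘(ℝ, F) x) : S.df x (S.JT x v) = Φ.J₁ (S.f x) (S.df x v) := by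
  rw [Φ.adapted x hx, df, S.JT_spec]

/-- The vectors which `J₂` keeps tangent to the submanifold. The maximal `Q`-invariant subspace of
the tangent space is the image of this subspace under the differential. -/
def AdaptedFrame.invariantPart (Φ : S.AdaptedFrame) (x : M) :
    Submodule ℝ (TangentSpace 𝓘(ℝ, F) x) :=
  (S.tangent x).comap (Φ.J₂ (S.f x) ∘L S.df x).toLinearMap

lemma AdaptedFrame.mem_invariantPart {Φ : S.AdaptedFrame} {x : M} {v : TangentSpace 𝓘(ℝ, F) x} :
    v ∈ Φ.invariantPart x ↔ ∃ u, S.df x u = Φ.J₂ (S.f x) (S.df x v) := Iff.rfl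

lemma AdaptedFrame.JT_mem_invariantPart (Φ : S.AdaptedFrame) {x : M} (hx : x ∈ Φ.U)
    {v : TangentSpace 𝓘(ℝ, F) x} (hv : v ∈ Φ.invariantPart x) : S.JT x v ∈ Φ.invariantPart x := by
  have T := Φ.isFrame.triple _ (Φ.mapsTo hx)
  obtain ⟨u, hu⟩ := mem_invariantPart.1 hv
  refine mem_invariantPart.2 ⟨-S.JT x u, ?_⟩
  rw [map_neg, Φ.df_JT hx, Φ.df_JT hx, hu, T.j₁₂, T.j₂₁]

lemma AdaptedFrame.maxQInvariant_eq (Φ : S.AdaptedFrame) {x : M} (hx : x ∈ Φ.U) :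
    S.maxQInvariant x = (Φ.invariantPart x).map (S.df x).toLinearMap := by
  have hxV := Φ.mapsTo hx
  have T := Φ.isFrame.triple _ hxV
  have hQ := Φ.isFrame.span _ hxV
  apply le_antisymm
  · refine sSup_le fun W hW w hw => ?_
    obtain ⟨v, rfl⟩ := hW.2 hw
    refine ⟨v, hW.2 (hW.1 (Φ.J₂ (S.f x)) ?_ _ hw), rfl⟩
    rw [hQ]
    exact Submodule.subset_span (by simp)
  · refine le_sSup ⟨?_, ?_⟩
    · have h₁ {w} (hw : w ∈ (Φ.invariantPart x).map (S.df x).toLinearMap) :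
          Φ.J₁ (S.f x) w ∈ (Φ.invariantPart x).map (S.df x).toLinearMap := by
        obtain ⟨v, hv, rfl⟩ := hw
        exact ⟨S.JT x v, Φ.JT_mem_invariantPart hx hv, Φ.df_JT hx v⟩
      have h₂ {w} (hw : w ∈ (Φ.invariantPart x).map (S.df x).toLinearMap) :
          Φ.J₂ (S.f x) w ∈ (Φ.invariantPart x).map (S.df x).toLinearMap := by
        obtain ⟨v, hv, rfl⟩ := hw
        obtain ⟨u, hu⟩ := mem_invariantPart.1 hv
        refine ⟨u, mem_invariantPart.2 ⟨v, ?_⟩, hu⟩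
        rw [hu, T.j₂₂, one_smul]
      intro A hA w hw
      rw [hQ, Submodule.mem_span_triple] at hA
      obtain ⟨a, b, c, rfl⟩ := hA
      refine add_mem (add_mem ?_ ?_) ?_
      · exact Submodule.smul_mem _ _ (h₁ hw)
      · exact Submodule.smul_mem _ _ (h₂ hw)
      · refine Submodule.smul_mem _ _ ?_
        have := h₁ (h₂ hw)
        rwa [T.j₁₂] at this
    · rintro _ ⟨v, -, rfl⟩
      exact ⟨v, rfl⟩

/-- The pullback of the ambient metric. -/
def inducedForm (S : AlmostEpsHermitianSubmanifold P ε F M) (x : M) :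
    TangentSpace 𝓘(ℝ, F) x →ₗ[ℝ] TangentSpace 𝓘(ℝ, F) x →ₗ[ℝ] ℝ :=
  LinearMap.mk₂ ℝ (fun v w => P.g.inner (S.f x) (S.df x v) (S.df x w)) (by simp) (by simp)
    (by simp) (by simp)

lemma inducedForm_JT (S : AlmostEpsHermitianSubmanifold P ε F M) (x : M)
    (v w : TangentSpace 𝓘(ℝ, F) x) :
    S.inducedForm x (S.JT x v) w = -S.inducedForm x v (S.JT x w) := by
  simp only [inducedForm, LinearMap.mk₂_apply, df, S.JT_spec]
  exact P.skew _ _ (S.J_mem x) _ _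

section Pointwise

variable [FiniteDimensional ℝ F]

lemma AdaptedFrame.finrank_invariantPart_add (Φ : S.AdaptedFrame) {x : M} (hx : x ∈ Φ.U)
    {D : Submodule ℝ (TangentSpace 𝓘(ℝ, E) (S.f x))} (hD : S.IsPureSupplement x D) :
    finrank ℝ (Φ.invariantPart x) + finrank ℝ D = finrank ℝ F := by
  have : FiniteDimensional ℝ (TangentSpace 𝓘(ℝ, F) x) := ‹FiniteDimensional ℝ F›
  have : FiniteDimensional ℝ (TangentSpace 𝓘(ℝ, E) (S.f x)) := ‹FiniteDimensional ℝ E›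
  have h := Submodule.finrank_sup_add_finrank_inf_eq (S.maxQInvariant x) D
  rw [hD.sup_eq, hD.inf_eq_bot, finrank_bot, Φ.maxQInvariant_eq hx,
    ← (Submodule.equivMapOfInjective _ (S.df_injective x) (Φ.invariantPart x)).finrank_eq] at h
  rw [← h, add_zero]
  exact (LinearMap.finrank_range_of_inj (S.df_injective x)).trans rfl

/-- `ψ` vanishes wherever the torsion vector takes its values in a sufficiently small invariant
subspace. -/
lemma AdaptedFrame.psi_eq_zero_of_torsionVector_mem (hε : ε = 1 ∨ ε = -1) (Φ : S.AdaptedFrame)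
    {x : M} (W : Submodule ℝ (TangentSpace 𝓘(ℝ, F) x)) (hW : ∀ v ∈ W, S.JT x v ∈ W)
    (hW₁ : ε = 1 →
      finrank ℝ ↥(W ⊓ LinearMap.ker ((S.JT x).toLinearMap - LinearMap.id)) =
        finrank ℝ ↥(W ⊓ LinearMap.ker ((S.JT x).toLinearMap + LinearMap.id)))
    (hdim : finrank ℝ W + 2 < finrank ℝ F) (h : ∀ X Y, Φ.torsionVector x X Y ∈ W) :
    Φ.psi x = 0 := by
  have : FiniteDimensional ℝ (TangentSpace 𝓘(ℝ, F) x) := ‹FiniteDimensional ℝ F›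
  ext v
  exact eq_zero_of_forall_sub_mem hε (J := (S.JT x).toLinearMap) (S.JT_JT x) (S.inducedForm x)
    (S.nondegenerate x) (S.inducedForm_JT x) W hW hW₁ hdim (Φ.psi x).toLinearMap h v

lemma AdaptedFrame.nijenhuisVanishesAt_iff (hε : ε = 1 ∨ ε = -1) (hF : 2 < finrank ℝ F)
    (Φ : S.AdaptedFrame) {x : M} (hx : x ∈ Φ.U) :
    NijenhuisVanishesAt ε S.JT x ↔ Φ.psi x = 0 := by
  have : CompleteSpace F := FiniteDimensional.complete ℝ F
  have T := Φ.isFrame.triple _ (Φ.mapsTo hx)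
  constructor
  · intro h
    refine Φ.psi_eq_zero_of_torsionVector_mem hε ⊥ (by simp)
      (fun _ => by rw [bot_inf_eq, bot_inf_eq]) (by simpa using hF)
      fun X Y => ?_
    obtain ⟨X, hX, rfl⟩ := exists_vectorField_eq X
    obtain ⟨Y, hY, rfl⟩ := exists_vectorField_eq Y
    have e := Φ.df_nijenhuis hε hx hX hY
    rw [h X Y hX hY, map_zero] at e
    have e2 := congrArg (Φ.J₂ (S.f x)) e
    rw [map_neg, T.j₂₂, map_zero, one_smul, eq_comm, neg_eq_zero] at e2
    exact (Submodule.mem_bot ℝ).2 ((map_eq_zero_iff _ (S.df_injective x)).1 e2)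
  · intro h X Y hX hY
    apply S.df_injective x
    rw [Φ.df_nijenhuis hε hx hX hY, torsionVector, h]
    simp

/-- The Nijenhuis tensor takes its values in the tangent space, so by the key formula the torsion
vector takes its values in the invariant part. Hence `ψ` vanishes where this is small. -/
lemma AdaptedFrame.psi_eq_zero_of_finrank_lt (hε : ε = 1 ∨ ε = -1) (Φ : S.AdaptedFrame) {x : M}
    (hx : x ∈ Φ.U) (hdim : finrank ℝ (Φ.invariantPart x) + 2 < finrank ℝ F) : Φ.psi x = 0 := by
  have : CompleteSpace F := FiniteDimensional.complete ℝ F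
  have : FiniteDimensional ℝ (TangentSpace 𝓘(ℝ, F) x) := ‹FiniteDimensional ℝ F›
  have : FiniteDimensional ℝ (TangentSpace 𝓘(ℝ, E) (S.f x)) := ‹FiniteDimensional ℝ E›
  have T := Φ.isFrame.triple _ (Φ.mapsTo hx)
  refine Φ.psi_eq_zero_of_torsionVector_mem hε (Φ.invariantPart x)
    (fun v => Φ.JT_mem_invariantPart hx) (fun _ => ?_) hdim fun X Y => ?_
  · exact finrank_comap_inf_ker_eq (D := (S.df x).toLinearMap) (S.df_injective x)
      (I := (Φ.J₁ (S.f x)).toLinearMap) (K := (Φ.J₂ (S.f x)).toLinearMap) (Φ.df_JT hx)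
      (fun v => (T.j₁₂ v).trans (neg_eq_iff_eq_neg.1 (T.j₂₁ v).symm |>.symm ▸ rfl))
      (fun v => (T.j₂₂ v).trans (one_smul ℝ v)) fun v => Iff.rfl
  · obtain ⟨X, hX, rfl⟩ := exists_vectorField_eq X
    obtain ⟨Y, hY, rfl⟩ := exists_vectorField_eq Y
    refine mem_invariantPart.2 ⟨-nijenhuis ε S.JT X Y x, ?_⟩
    rw [map_neg, Φ.df_nijenhuis hε hx hX hY, neg_neg]

/-- The dimension of the invariant part is upper semicontinuous: in coordinates it is the dimension
of the kernel of `(1 - df ∘ dr) ∘ J₂ ∘ df`, where `r` is a local left inverse of the immersion. -/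
lemma AdaptedFrame.eventually_finrank_invariantPart_le (Φ : S.AdaptedFrame) {x₀ : M}
    (hx : x₀ ∈ Φ.U) :
    ∀ᶠ y in 𝓝 x₀, finrank ℝ (Φ.invariantPart y) ≤ finrank ℝ (Φ.invariantPart x₀) := by
  have : IsManifold 𝓘(ℝ, F) (∞ + 1) M := ‹IsManifold 𝓘(ℝ, F) ∞ M›
  have : IsManifold 𝓘(ℝ, E) (∞ + 1) N := ‹IsManifold 𝓘(ℝ, E) ∞ N›
  have hf : ContMDiff 𝓘(ℝ, F) 𝓘(ℝ, E) ∞ S.f := S.isImmersion.contMDiff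
  obtain ⟨r, V, hV, hxV, hr, hrf⟩ := exists_local_leftInverse S.isImmersion x₀
  have hrx : r (S.f x₀) = x₀ := hrf.self_of_nhds
  -- the maps `df`, `dr` and `J₂` in coordinates
  let D (y : M) : F →L[ℝ] E := tangentCoord (S.f x₀) (S.f y) ∘L S.df y ∘L tangentCoordSymm x₀ y
  let R (y : M) : E →L[ℝ] F := tangentCoord x₀ (r (S.f y)) ∘L
    mfderiv 𝓘(ℝ, E) 𝓘(ℝ, F) r (S.f y) ∘L tangentCoordSymm (S.f x₀) (S.f y)
  let K (y : M) : E →L[ℝ] E := tangentCoord (S.f x₀) (S.f y) ∘L Φ.J₂ (S.f y) ∘L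
    tangentCoordSymm (S.f x₀) (S.f y)
  have cD : ContinuousAt D x₀ :=
    (ContMDiffAt.mfderiv_const (m := ∞) (hf x₀) (by simp)).continuousAt
  have cR : ContinuousAt R x₀ := by
    have := ((ContMDiffAt.mfderiv_const (m := ∞) (hr.contMDiffAt (hV.mem_nhds hxV))
      (by simp)).comp x₀ (hf x₀)).continuousAt
    refine this.congr (Filter.Eventually.of_forall fun y => ?_)
    simp only [inTangentCoordinates, Function.comp_apply, id, hrx]
    rfl
  have cK : ContinuousAt K x₀ :=
    (((contMDiffAt_hom_bundle _).1 (Φ.isFrame.smooth₂.contMDiffAt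
      (Φ.isOpen_V.mem_nhds (Φ.mapsTo hx)))).2.comp x₀ (hf x₀)).continuousAt
  let T (y : M) : F →L[ℝ] E := K y ∘L D y - D y ∘L R y ∘L K y ∘L D y
  have cT : ContinuousAt T x₀ :=
    (cK.clm_comp cD).sub (cD.clm_comp (cR.clm_comp (cK.clm_comp cD)))
  have hrank : ∀ᶠ y in 𝓝 x₀, finrank ℝ (LinearMap.range (T y).toLinearMap) +
      finrank ℝ (Φ.invariantPart y) = finrank ℝ F := by
    filter_upwards [eventually_mfderiv_leftInverse hf hV hxV hr hrf,
      (chartAt F x₀).open_source.mem_nhds (mem_chart_source F x₀),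
      hf.continuous.continuousAt.eventually
        ((chartAt E (S.f x₀)).open_source.mem_nhds (mem_chart_source E (S.f x₀)))] with y hy hyM hyN
    have hD (v : TangentSpace 𝓘(ℝ, F) y) :
        D y (tangentCoord x₀ y v) = tangentCoord (S.f x₀) (S.f y) (S.df y v) := by
      simp only [D, ContinuousLinearMap.comp_apply, tangentCoordSymm_coord hyM]
    have hK (w : TangentSpace 𝓘(ℝ, E) (S.f y)) : K y (tangentCoord (S.f x₀) (S.f y) w) =
        tangentCoord (S.f x₀) (S.f y) (Φ.J₂ (S.f y) w) := by
      simp only [K, ContinuousLinearMap.comp_apply, tangentCoordSymm_coord hyN]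
    let dr : TangentSpace 𝓘(ℝ, E) (S.f y) →L[ℝ] TangentSpace 𝓘(ℝ, F) y :=
      mfderiv 𝓘(ℝ, E) 𝓘(ℝ, F) r (S.f y)
    have hdr (v : TangentSpace 𝓘(ℝ, F) y) : dr (S.df y v) = v := hy.2.2 v
    have hR (w : TangentSpace 𝓘(ℝ, E) (S.f y)) : R y (tangentCoord (S.f x₀) (S.f y) w) =
        tangentCoord x₀ y (dr w) := by
      have e (u : F) : tangentCoord (F := F) x₀ (r (S.f y)) u = tangentCoord (F := F) x₀ y u := by
        rw [hy.2.1]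
      simp only [R, ContinuousLinearMap.comp_apply, tangentCoordSymm_coord hyN]
      exact e _
    have hT (v : TangentSpace 𝓘(ℝ, F) y) :
        T y (tangentCoord x₀ y v) = 0 ↔ v ∈ Φ.invariantPart y := by
      simp only [T, sub_apply, ContinuousLinearMap.comp_apply, hD, hK, hR]
      rw [sub_eq_zero, (tangentCoord_injective hyN).eq_iff, mem_invariantPart]
      refine ⟨fun h => ⟨_, h.symm⟩, ?_⟩
      rintro ⟨u, hu⟩
      rw [← hu, hdr]
    have hker : LinearMap.ker (T y).toLinearMap =
        (Φ.invariantPart y).map (tangentCoord (F := F) x₀ y).toLinearMap := by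
      ext v
      rw [LinearMap.mem_ker, Submodule.mem_map]
      constructor
      · intro h
        refine ⟨tangentCoordSymm x₀ y v, (hT _).1 ?_, tangentCoord_symm hyM v⟩
        rwa [tangentCoord_symm hyM]
      · rintro ⟨u, hu, rfl⟩
        exact (hT u).2 hu
    rw [(Submodule.equivMapOfInjective (tangentCoord (F := F) x₀ y).toLinearMap
      (tangentCoord_injective hyM) (Φ.invariantPart y)).finrank_eq, ← hker]
    exact LinearMap.finrank_range_add_finrank_ker _
  filter_upwards [hrank, cT.eventually ((isOpen_setOfPred_nat_le_rank
    (finrank ℝ (LinearMap.range (T x₀).toLinearMap))).mem_nhds (finrank_eq_rank _ _).le)]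
    with y hy hy'
  have h₀ := hrank.self_of_nhds
  have h₁ : finrank ℝ (LinearMap.range (T x₀).toLinearMap) ≤
      finrank ℝ (LinearMap.range (T y).toLinearMap) := by
    have := hy'.trans (finrank_eq_rank ℝ (LinearMap.range (T y).toLinearMap)).ge
    exact_mod_cast this
  omega

end Pointwise

end AlmostEpsHermitianSubmanifold

end

theorem theorem3p4
    {E : Type*} [NormedAddCommGroup E] [NormedSpace ℝ E] [FiniteDimensional ℝ E]
    {N : Type*} [TopologicalSpace N] [T2Space N] [SecondCountableTopology N]
    [ChartedSpace E N] [IsManifold 𝓘(ℝ, E) ∞ N]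
    {F : Type*} [NormedAddCommGroup F] [NormedSpace ℝ F] [FiniteDimensional ℝ F]
    {M : Type*} [TopologicalSpace M] [T2Space M] [SecondCountableTopology M]
    [ChartedSpace F M] [IsManifold 𝓘(ℝ, F) ∞ M]
    (n m : ℕ) (hE : Module.finrank ℝ E = 4 * n) (hF : Module.finrank ℝ F = 2 * m) (hm : 1 < m)
    (P : ParaQuaternionicKahlerStructure E N)
    (ε : ℝ) (hε : ε = 1 ∨ ε = -1)
    (S : AlmostEpsHermitianSubmanifold P ε F M) :
    -- (1) the form `ψ` detects integrability, globally and on the domain of each adapted frame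
    ((IsIntegrableOn ε S.JT Set.univ ↔ ∀ Φ : S.AdaptedFrame, ∀ x ∈ Φ.U, Φ.psi x = 0) ∧
      (∀ Φ : S.AdaptedFrame, IsIntegrableOn ε S.JT Φ.U ↔ ∀ x ∈ Φ.U, Φ.psi x = 0)) ∧
    -- (2a)
    ((∃ U : Set M, IsOpen U ∧ Dense U ∧
        ∀ x ∈ U, ∃ D, S.IsPureSupplement x D ∧ 2 < Module.finrank ℝ D) →
      IsIntegrableOn ε S.JT Set.univ) ∧
    -- (2b) `M` connected, with an analytic atlas for which the structure is analytic
    (ConnectedSpace M → IsManifold 𝓘(ℝ, F) ω M → EndFieldContMDiffOn ω S.JT Set.univ →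
      (∃ x : M, ∃ D, S.IsPureSupplement x D ∧ 2 < Module.finrank ℝ D) →
      IsIntegrableOn ε S.JT Set.univ) := by
  have : CompleteSpace F := FiniteDimensional.complete ℝ F
  have hF2 : 2 < finrank ℝ F := by omega
  have hsm := S.JT_smooth
  have hint (U : Set M) (hU : IsOpen U) := isIntegrableOn_iff hsm S.JT_JT hU
  have hadapted (x : M) : ∃ Φ : S.AdaptedFrame, x ∈ Φ.U := by
    have : Nontrivial E := by
      have : Nontrivial (TangentSpace 𝓘(ℝ, F) x) :=
        nontrivial_of_finrank_pos (R := ℝ) (M := F) (by omega)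
      exact (S.df_injective x).nontrivial
    exact S.exists_adaptedFrame hε x
  have hlocal (Φ : S.AdaptedFrame) : IsIntegrableOn ε S.JT Φ.U ↔ ∀ x ∈ Φ.U, Φ.psi x = 0 := by
    rw [hint _ Φ.isOpen_U]
    exact forall₂_congr fun x hx => Φ.nijenhuisVanishesAt_iff hε hF2 hx
  have hsmall {Φ : S.AdaptedFrame} {x : M} (hx : x ∈ Φ.U)
      (h : ∃ D, S.IsPureSupplement x D ∧ 2 < Module.finrank ℝ D) :
      finrank ℝ (Φ.invariantPart x) + 2 < finrank ℝ F := by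
    obtain ⟨D, hD, hD2⟩ := h
    have := Φ.finrank_invariantPart_add hx hD
    omega
  refine ⟨⟨⟨fun h Φ => ?_, fun h => ?_⟩, hlocal⟩, ?_, ?_⟩
  · exact (hlocal Φ).1 fun V hV => h V (Set.subset_univ V)
  · refine (hint _ isOpen_univ).2 fun x _ => ?_
    obtain ⟨Φ, hx⟩ := hadapted x
    exact (Φ.nijenhuisVanishesAt_iff hε hF2 hx).2 (h Φ x hx)
  · rintro ⟨U, -, hU, h⟩
    refine (hint _ isOpen_univ).2 fun x _ => ?_
    refine nijenhuisVanishesAt_of_dense hsm S.JT_JT hU (fun y hy => ?_) x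
    obtain ⟨Φ, hyΦ⟩ := hadapted y
    exact (Φ.nijenhuisVanishesAt_iff hε hF2 hyΦ).2
      (Φ.psi_eq_zero_of_finrank_lt hε hyΦ (hsmall hyΦ (h y hy)))
  · rintro _ _ hω ⟨x, h⟩
    refine (hint _ isOpen_univ).2 fun z _ => ?_
    refine nijenhuisVanishesAt_of_analytic hsm hω S.JT_JT (x₀ := x) ?_ z
    obtain ⟨Φ, hxΦ⟩ := hadapted x
    have hdim := hsmall hxΦ h
    filter_upwards [Φ.isOpen_U.mem_nhds hxΦ, Φ.eventually_finrank_invariantPart_le hxΦ]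
      with y hyΦ hy
    exact (Φ.nijenhuisVanishesAt_iff hε hF2 hyΦ).2
      (Φ.psi_eq_zero_of_finrank_lt hε hyΦ (by omega))
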